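/- Let $\mathcal D$ be a non-principal ultrafilter on the set $P$ of primes, ${}^*\mathbb Z=\mathbb Z^P/\mathcal D$, ${}^*\mathbb C=\mathbb C^P/\mathcal D$ (so ${}^*\mathbb Z\subset{}^*\mathbb C$), let $\mathfrak p\in{}^*\mathbb Z$ be the class of $(p)_{p\in P}$ and let $\mathrm F_{\mathfrak p}=\prod_{p\in P}\mathbb F_p/\mathcal D\cong{}^*\mathbb Z/\mathfrak p$; nonstandard integers are viewed in $\mathrm F_{\mathfrak p}$ by reduction. For $x\in \mathrm F_{\mathfrak p}^\times$ and $n\in{}^*\mathbb Z$ the power $x^n$ is computed coordinatewise, and $\epsilon\in\mathrm F_{\mathfrak p}^\times$ is called a generator if every element of $\mathrm F_{\mathfrak p}^\times$ is $\epsilon^n$ for some $n\in{}^*\mathbb Z$. Assume that every standard positive integer divides $\mathfrak p-1$. For positive $\mu,\iota\in{}^*\mathbb Z$ put $\mathfrak l=\mu^2$, $\mathfrak i=\iota^2$, and call $(\mu,\iota)$ admissible if 1. every standard positive integer divides $\mathfrak l$, and $m\,\mathfrak l\,\mathfrak i\mid\mathfrak p-1$ for every standard positive integer $m$; 2. $\mathfrak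 i>\mathfrak l^n$ for every standard $n$; 3. either $\mathfrak i^2+1=\mathfrak p$, or $\mathfrak i,\mathfrak l$ are algebraically independent (over the prime field $\mathbb Q$) in $\mathrm F_{\mathfrak p}$; and $\mathfrak l$ is transcendental over $\mathbb Q(\mathfrak i)$ in $\mathrm F_{\mathfrak p}$. Consider the following property of $(\mu,\iota)$: (∗) there are a generator $\epsilon$ of $\mathrm F_{\mathfrak p}^\times$ and a place $\mathcal I:\mathrm F_{\mathfrak p}\to{}^*\mathbb C\cup\{\infty\}$ such that $$\mu\mapsto\mu,\quad \mathfrak l\mapsto\mathfrak l,\quad \iota\mapsto e^{-\pi i/4},\quad \mathfrak i\mapsto e^{-\pi i/2},$$ and for all $a\in\mathbb Q$ and all $M\in{}^*\mathbb Z$ with $|M|<\mathfrak l$ the exponents below are nonstandard integers and $$\epsilon^{\frac{aM(\mathfrak p-1)}{2\mathfrak l}}\mapsto e^{-\frac{aM\pi i}{\mathfrak l}},\qquad \epsilon^{\frac{aM(\mathfrak p-1)}{2\mathfrak l\mathfrak i}}\mapsto e^{-\frac{aM\pi}{\mathfrak l}}.$$ Then: (a) there is an admissible pair $(\mu,\iota)$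 with $\mathfrak i,\mathfrak l$ algebraically independent in $\mathrm F_{\mathfrak p}$ that satisfies (∗); (b) for every positive $\iota\in{}^*\mathbb Z$ with $\iota^4+1=\mathfrak p$ there is $\mu$ such that $(\mu,\iota)$ is admissible and satisfies (∗). -/

import Mathlib

open Filter

namespace PseudoFinite

instance primeFact (p : Nat.Primes) : Fact (p : ℕ).Prime := ⟨p.2⟩

/-- Nonstandard integers: the ultrapower of the ring of integers over the set of primes. -/
abbrev StarZ (D : Ultrafilter Nat.Primes) : Type :=
  Germ (D : Filter Nat.Primes) ℤ

/-- The nonstandard model of the complex numbers, an ultrapower over the set of primes. -/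
abbrev StarC (D : Ultrafilter Nat.Primes) : Type :=
  Germ (D : Filter Nat.Primes) ℂ

/-- The ideal of those families of elements of the `ZMod p` that vanish for `D`-almost all `p`. -/
def nullIdeal (D : Ultrafilter Nat.Primes) : Ideal ((p : Nat.Primes) → ZMod p) where
  carrier := {x | ∀ᶠ p in (D : Filter Nat.Primes), x p = 0}
  zero_mem' := Eventually.of_forall fun _ => rfl
  add_mem' := by
    intro x y hx hy
    filter_upwards [hx, hy] with p h1 h2
    simp [h1, h2]
  smul_mem' := by
    intro c x hx
    filter_upwards [hx] with p h1
    simp [h1]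

theorem mem_nullIdeal {D : Ultrafilter Nat.Primes} {x : (p : Nat.Primes) → ZMod p} :
    x ∈ nullIdeal D ↔ ∀ᶠ p in (D : Filter Nat.Primes), x p = 0 := Iff.rfl

instance nullIdeal_isMaximal (D : Ultrafilter Nat.Primes) : (nullIdeal D).IsMaximal := by
  rw [Ideal.isMaximal_iff]
  constructor
  · rw [mem_nullIdeal]
    intro h
    obtain ⟨p, hp⟩ := h.exists
    exact one_ne_zero hp
  · intro J x hJ hx hxJ
    have h0 : ∀ᶠ p in (D : Filter Nat.Primes), x p ≠ 0 :=
      Ultrafilter.eventually_not.mpr hx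
    have h1 : (1 - x⁻¹ * x : (p : Nat.Primes) → ZMod p) ∈ nullIdeal D := by
      rw [mem_nullIdeal]
      filter_upwards [h0] with p hp
      simp [hp]
    have h2 := J.add_mem (hJ h1) (J.mul_mem_left x⁻¹ hxJ)
    simpa using h2

/-- The ultraproduct of the prime fields `ZMod p` along `D`. -/
abbrev Fp (D : Ultrafilter Nat.Primes) : Type :=
  ((p : Nat.Primes) → ZMod p) ⧸ nullIdeal D

noncomputable instance fieldFp (D : Ultrafilter Nat.Primes) : Field (Fp D) :=
  Ideal.Quotient.field (nullIdeal D)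

/-- The nonstandard prime: the class of the family `p ↦ p`. -/
def npr (D : Ultrafilter Nat.Primes) : StarZ D :=
  ((fun p : Nat.Primes => ((p : ℕ) : ℤ)) : Nat.Primes → ℤ)

/-- Reduction of nonstandard integers modulo the nonstandard prime. -/
def red (D : Ultrafilter Nat.Primes) (n : StarZ D) : Fp D :=
  Quotient.liftOn' n
    (fun f => Ideal.Quotient.mk (nullIdeal D) (fun p => ((f p : ℤ) : ZMod p)))
    (by
      intro f g h
      rw [Ideal.Quotient.eq, mem_nullIdeal]
      have h' : ∀ᶠ p in (D : Filter Nat.Primes), f p = g p := h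
      filter_upwards [h'] with p hp
      simp [hp])

/-- Internal powers `x ^ n` for a nonstandard integer `n`, computed coordinatewise. -/
def ipow {D : Ultrafilter Nat.Primes} (x : Fp D) (n : StarZ D) : Fp D :=
  Quotient.liftOn₂' x n
    (fun f e => Ideal.Quotient.mk (nullIdeal D) (fun p => f p ^ e p))
    (by
      intro f e g e' hf he
      rw [Submodule.quotientRel_def, mem_nullIdeal] at hf
      have he' : ∀ᶠ p in (D : Filter Nat.Primes), e p = e' p := he
      rw [Ideal.Quotient.eq, mem_nullIdeal]
      filter_upwards [hf, he'] with p h1 h2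
      have h3 : f p = g p := sub_eq_zero.mp h1
      simp [h2, h3])

/-- `ε` generates the multiplicative group in the pseudo-finite sense. -/
def IsGenerator {D : Ultrafilter Nat.Primes} (ε : Fp D) : Prop :=
  ε ≠ 0 ∧ ∀ x : Fp D, x ≠ 0 → ∃ n : StarZ D, ipow ε n = x

/-- The inclusion of the nonstandard integers in the nonstandard complex numbers. -/
def toC {D : Ultrafilter Nat.Primes} (n : StarZ D) : StarC D :=
  Germ.map (fun k : ℤ => (k : ℂ)) n

/-- The inclusion of the complex numbers in the nonstandard complex numbers. -/
def std (D : Ultrafilter Nat.Primes) (z : ℂ) : StarC D :=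
  Germ.const z

/-- The nonstandard extension of the complex exponential. -/
noncomputable def expC {D : Ultrafilter Nat.Primes} (z : StarC D) : StarC D :=
  Germ.map Complex.exp z

/-- A place of the field `K` with values in the field `L` with a point `∞` added: the finite
elements form a subring on which the map is a ring homomorphism, and the elements sent to `∞` are
the inverses of the nonzero elements sent to `0`. -/
structure Place (K L : Type*) [Field K] [Field L] where
  toFun : K → OnePoint L
  map_one : toFun 1 = ((1 : L) : OnePoint L)
  map_add : ∀ (x y : K) (a b : L), toFun x = (a : OnePoint L) → toFun y = (b : OnePoint L) →
    toFun (x + y) = ((a + b : L) : OnePoint L)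
  map_mul : ∀ (x y : K) (a b : L), toFun x = (a : OnePoint L) → toFun y = (b : OnePoint L) →
    toFun (x * y) = ((a * b : L) : OnePoint L)
  map_infty : ∀ x : K, toFun x = OnePoint.infty ↔
    x ≠ 0 ∧ toFun x⁻¹ = ((0 : L) : OnePoint L)

/-- The assumptions on `𝔩 = μ ^ 2` and `𝔦 = ι ^ 2`. -/
structure Admissible (D : Ultrafilter Nat.Primes) (μ ι : StarZ D) : Prop where
  mu_pos : 0 < μ
  iota_pos : 0 < ι
  highly_divisible : ∀ m : ℕ, 0 < m → (m : StarZ D) ∣ μ ^ 2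
  dvd : ∀ m : ℕ, 0 < m → (m : StarZ D) * (μ ^ 2 * ι ^ 2) ∣ npr D - 1
  growth : ∀ n : ℕ, (μ ^ 2) ^ n < ι ^ 2
  dichotomy : (ι ^ 2) ^ 2 + 1 = npr D ∨
    AlgebraicIndependent ℤ ![red D (ι ^ 2), red D (μ ^ 2)]
  transcendental : Transcendental (Subfield.closure {red D (ι ^ 2)}) (red D (μ ^ 2))

/-- The prescribed values of the place `I`. The elements `E` are the exponents
`a M (𝔭 - 1) / (2 𝔩)` and `a M (𝔭 - 1) / (2 𝔩 𝔦)`, which are nonstandard integers. -/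
structure HasValues {D : Ultrafilter Nat.Primes} (μ ι : StarZ D) (ε : Fp D)
    (I : Place (Fp D) (StarC D)) : Prop where
  map_mu : I.toFun (red D μ) = (toC μ : StarC D)
  map_l : I.toFun (red D (μ ^ 2)) = (toC (μ ^ 2) : StarC D)
  map_iota : I.toFun (red D ι) =
    (std D (Complex.exp (-(Real.pi * Complex.I / 4))) : StarC D)
  map_i : I.toFun (red D (ι ^ 2)) =
    (std D (Complex.exp (-(Real.pi * Complex.I / 2))) : StarC D)
  map_S : ∀ (a : ℚ) (M : StarZ D), |M| < μ ^ 2 → ∃ E : StarZ D,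
    toC E = std D a * toC M * toC (npr D - 1) / toC (2 * μ ^ 2) ∧
    I.toFun (ipow ε E) =
      (expC (-(std D a * toC M * std D (Real.pi * Complex.I) / toC (μ ^ 2))) : StarC D)
  map_R : ∀ (a : ℚ) (M : StarZ D), |M| < μ ^ 2 → ∃ E : StarZ D,
    toC E = std D a * toC M * toC (npr D - 1) / toC (2 * μ ^ 2 * ι ^ 2) ∧
    I.toFun (ipow ε E) =
      (expC (-(std D a * toC M * std D Real.pi / toC (μ ^ 2))) : StarC D)

end PseudoFinite

/-!
The level `k` version of the situation has `μ = k !`, `𝔩 = μ ^ 2` and `N = 2 * 𝔩 ^ 2`. For a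
primitive root `ε` modulo `p`, put `ζ = ε ^ ((p - 1) / N)` and
`θ = ε ^ ((p - 1) / (N * ι ^ 2))`. At a level that tends to infinity along the ultrafilter, every prescribed power of the
generator is a power of `ζ` or of `θ` with exponent at most `k * 𝔩 ^ 2` in absolute value, so
`ζ` has to be sent to `exp (-2πi / N)` and `θ` to `exp (-2π / N)`.

A homomorphism from a subring of a field to an algebraically closed field extends to a place
(`exists_place_of_isFunctional`), and an ultrapower of `ℂ` is algebraically closed. Hence it is
enough that every polynomial relation between `μ`, `ι`, the powers of `ζ` and the powers of `θ`
is respected by the prescribed values. At level `k` only a finite set of relations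
(`levelFiltration k k`) has to be considered, and a diagonal argument (`exists_level`) then
reduces everything to one fixed level and almost all primes. There are three reasons why a
relation modulo `p` is respected.

* The root of unity `θ` can be chosen outside any small finite set: once `ζ` is given, there are
  at least `ι` candidates for `θ` that come from a primitive root
  (`exists_isPrimitiveRoot_pow_notMem`). So the relation may be assumed to hold identically in
  `θ`.
* A fixed integral polynomial that does not vanish at a complex primitive `N`-th root of unity
  vanishes at a primitive `N`-th root of unity modulo `p` only for finitely many `p`
  (`exists_int_of_aeval_ne_zero`). So the relation holds for the complex value of `ζ`.
* If `ι ^ 4 + 1 = p`, then `ι` is a primitive eighth root of unity modulo `p`, and `ε` can be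
  chosen so that `ι` is a power of `ζ`; the relation then involves `ζ` alone. If `ι` may be
  chosen, it is a large constant at each level, so that it is not a root of any of the finitely
  many polynomials concerned unless they vanish identically; then `ι` can be sent to any complex
  number.

The last remark, together with the transcendence of the infinite number `μ` in the nonstandard
complex numbers, also gives the algebraic independence of `ι ^ 2` and `μ ^ 2`.
-/

namespace PseudoFinite

/-! ### Extension of homomorphisms to places -/

section PlaceExtension

variable {K Ω : Type*} [Field K] [Field Ω]

/-- A subring of `K × Ω` is regarded as a ring homomorphism from a subring of `K` to `Ω`, given by
its graph. This is the condition for it to be single-valued. -/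
def IsFunctional (G : Subring (K × Ω)) : Prop := ∀ y, ((0 : K), y) ∈ G → y = 0

theorem IsFunctional.unique {G : Subring (K × Ω)} (hG : IsFunctional G) {x : K} {y y' : Ω}
    (h : (x, y) ∈ G) (h' : (x, y') ∈ G) : y = y' := by
  have := G.sub_mem h h'
  rw [Prod.mk_sub_mk, sub_self] at this
  exact sub_eq_zero.mp (hG _ this)

theorem IsFunctional.ne_zero {G : Subring (K × Ω)} (hG : IsFunctional G) {x : K} {y : Ω}
    (h : (x, y) ∈ G) (hy : y ≠ 0) : x ≠ 0 := by
  rintro rfl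
  exact hy (hG y h)

/-- Zorn's lemma: the union of a chain of single-valued graphs is single-valued. -/
theorem exists_maximal_isFunctional {G : Subring (K × Ω)} (hG : IsFunctional G) :
    ∃ M, G ≤ M ∧ Maximal IsFunctional M := by
  refine zorn_le_nonempty₀ {G | IsFunctional G} ?_ G hG
  intro c hc hchain y hy
  refine ⟨sSup c, ?_, fun z hz => le_sSup hz⟩
  intro z hz
  obtain ⟨H, hH, hzH⟩ :=
    (Subring.mem_sSup_of_directedOn ⟨y, hy⟩ hchain.directedOn).mp hz
  exact hc hH z hzH

/-- The domain of a maximal partial homomorphism is local: elements with a nonzero value are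
invertible. Otherwise the homomorphism extends to the localization. -/
theorem inv_mem_of_maximal {G : Subring (K × Ω)} (hG : Maximal IsFunctional G) {a : K} {b : Ω}
    (hab : (a, b) ∈ G) (hb : b ≠ 0) : (a⁻¹, b⁻¹) ∈ G := by
  -- The graph of the extension to the fractions whose denominators have a nonzero value.
  let G' : Subring (K × Ω) :=
    { carrier := {z | ∃ s ∈ G, s.2 ≠ 0 ∧ s * z ∈ G}
      one_mem' := ⟨1, G.one_mem, by simp, by simp⟩
      zero_mem' := ⟨1, G.one_mem, by simp, by simp⟩
      mul_mem' := by
        rintro z w ⟨s, hs, hs0, hsz⟩ ⟨t, ht, ht0, htw⟩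
        refine ⟨s * t, G.mul_mem hs ht, mul_ne_zero hs0 ht0, ?_⟩
        convert G.mul_mem hsz htw using 1
        ring
      add_mem' := by
        rintro z w ⟨s, hs, hs0, hsz⟩ ⟨t, ht, ht0, htw⟩
        refine ⟨s * t, G.mul_mem hs ht, mul_ne_zero hs0 ht0, ?_⟩
        convert G.add_mem (G.mul_mem ht hsz) (G.mul_mem hs htw) using 1
        ring
      neg_mem' := by
        rintro z ⟨s, hs, hs0, hsz⟩
        refine ⟨s, hs, hs0, ?_⟩
        simpa using G.neg_mem hsz }
  have hle : G ≤ G' := fun z hz => ⟨1, G.one_mem, by simp, by simpa using hz⟩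
  have hfun : IsFunctional G' := by
    rintro y ⟨⟨s₁, s₂⟩, hs, hs0, hsy⟩
    rw [Prod.mk_mul_mk, mul_zero] at hsy
    exact (mul_eq_zero.mp (hG.prop _ hsy)).resolve_left hs0
  refine hG.le_of_ge hfun hle ⟨(a, b), hab, hb, ?_⟩
  rw [Prod.mk_mul_mk, mul_inv_cancel₀ (hG.prop.ne_zero hab hb), mul_inv_cancel₀ hb]
  exact G.one_mem

/-- A maximal partial homomorphism is defined at `x` unless the relations satisfied by `x` over
its domain become contradictory when the homomorphism is applied to their coefficients. -/
theorem exists_mem_of_maximal [IsAlgClosed Ω] {G : Subring (K × Ω)} (hG : Maximal IsFunctional G)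
    (x : K)
    (hx : ∀ P : Polynomial G, P.eval₂ ((RingHom.fst K Ω).comp G.subtype) x = 0 →
      P.map ((RingHom.snd K Ω).comp G.subtype) ≠ 1) :
    ∃ y, (x, y) ∈ G := by
  set f₁ := (RingHom.fst K Ω).comp G.subtype
  set f₂ := (RingHom.snd K Ω).comp G.subtype with hf₂
  -- The values of the homomorphism form a field by `inv_mem_of_maximal`, so the relations of `x`,
  -- with the homomorphism applied to their coefficients, form a principal ideal of `k[X]`. A root
  -- of its generator is a possible value at `x`.
  let k : Subfield Ω :=
    { f₂.range with
      inv_mem' := by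
        rintro _ ⟨⟨⟨a, b⟩, hab⟩, rfl⟩
        by_cases hb : b = 0
        · subst hb
          exact ⟨0, by simp [hf₂]⟩
        · exact ⟨⟨_, inv_mem_of_maximal hG hab hb⟩, by simp [hf₂]⟩ }
  let g : G →+* k := f₂.codRestrict k fun z => ⟨z, rfl⟩
  have hg : Function.Surjective g := by
    rintro ⟨_, z, rfl⟩
    exact ⟨z, rfl⟩
  have hgf : (algebraMap k Ω).comp g = f₂ := rfl
  let π : Polynomial G →+* Polynomial k := Polynomial.mapRingHom g
  have hπ : Function.Surjective π := Polynomial.map_surjective g hg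
  let J : Ideal (Polynomial G) := RingHom.ker (Polynomial.eval₂RingHom f₁ x)
  have hI : J.map π ≠ ⊤ := by
    rw [Ne, Ideal.eq_top_iff_one, Ideal.mem_map_iff_of_surjective π hπ]
    rintro ⟨P, hPJ, hP⟩
    refine hx P hPJ ?_
    have := congrArg (Polynomial.map (algebraMap k Ω)) hP
    rwa [Polynomial.coe_mapRingHom, Polynomial.map_map, hgf, Polynomial.map_one] at this
  obtain ⟨q, hq⟩ := (IsPrincipalIdealRing.principal (J.map π)).principal
  have hqu : ¬ IsUnit q := fun h => hI (by rw [hq]; exact Ideal.span_singleton_eq_top.mpr h)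
  obtain ⟨y, hy⟩ : ∃ y : Ω, Polynomial.aeval y q = 0 := by
    by_cases hq0 : q = 0
    · exact ⟨0, by simp [hq0]⟩
    · exact IsAlgClosed.exists_aeval_eq_zero Ω q
        fun h => hqu (Polynomial.isUnit_iff_degree_eq_zero.mpr h)
  refine ⟨y, ?_⟩
  let e : Polynomial G →+* K × Ω := Polynomial.eval₂RingHom G.subtype (x, y)
  have he₁ (P : Polynomial G) : (e P).1 = P.eval₂ f₁ x :=
    Polynomial.hom_eval₂ P G.subtype (RingHom.fst K Ω) (x, y)
  have he₂ (P : Polynomial G) : (e P).2 = P.eval₂ f₂ y :=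
    Polynomial.hom_eval₂ P G.subtype (RingHom.snd K Ω) (x, y)
  -- The graph generated by `G` and `(x, y)` is still single-valued.
  have hfun : IsFunctional e.range := by
    rintro z ⟨P, hP⟩
    have h1 : P ∈ J := by
      change P.eval₂ f₁ x = 0
      rw [← he₁, hP]
    have h2 : π P ∈ Ideal.span {q} := by
      have := Ideal.mem_map_of_mem π h1
      rwa [hq] at this
    obtain ⟨r, hr⟩ := Ideal.mem_span_singleton.mp h2
    have h3 : Polynomial.aeval y (π P) = 0 := by rw [hr, map_mul, hy, zero_mul]
    have h4 := he₂ P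
    rw [hP] at h4
    rw [show z = P.eval₂ f₂ y from h4, ← hgf, ← Polynomial.eval₂_map]
    exact h3
  have hle : G ≤ e.range := fun z hz => ⟨Polynomial.C ⟨z, hz⟩, by simp [e]⟩
  exact hG.le_of_ge hfun hle ⟨Polynomial.X, by simp [e]⟩

/-- The domain of a maximal partial homomorphism to an algebraically closed field is a valuation
ring. It is compared with a valuation ring that dominates it. -/
theorem exists_mem_or_inv_mem_of_maximal [IsAlgClosed Ω] {G : Subring (K × Ω)}
    (hG : Maximal IsFunctional G) (x : K) : (∃ y, (x, y) ∈ G) ∨ ∃ y, (x⁻¹, y) ∈ G := by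
  let A : Subring K := G.map (RingHom.fst K Ω)
  have hA {a : K} : a ∈ A ↔ ∃ b, (a, b) ∈ G := by simp [A]
  -- The kernel of the partial homomorphism, as an ideal of its domain.
  let I : Ideal A :=
    { carrier := {a | ((a : K), (0 : Ω)) ∈ G}
      zero_mem' := G.zero_mem
      add_mem' := by
        intro a b ha hb
        simpa using G.add_mem ha hb
      smul_mem' := by
        intro c a ha
        obtain ⟨b, hb⟩ := hA.mp c.2
        simpa using G.mul_mem hb ha }
  have hI : I ≠ ⊤ := by
    rw [Ne, Ideal.eq_top_iff_one]
    intro h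
    exact zero_ne_one (hG.prop.unique (show ((1 : K), (0 : Ω)) ∈ G from h) G.one_mem)
  obtain ⟨V, -, hIV⟩ := Ideal.image_subset_nonunits_valuationSubring I hI
  have key (z : K) (hz : z ∈ V) : ∃ y, (z, y) ∈ G := by
    refine exists_mem_of_maximal hG z fun P hP hP1 => ?_
    -- The coefficients of `P - 1` lie in the maximal ideal of `V`, so `P - 1` cannot take the
    -- value `-1` at `z`.
    have hcoeff (i : ℕ) : V.valuation ((P - 1).coeff i : K × Ω).1 < 1 := by
      rw [← ValuationSubring.mem_nonunits_iff]
      have h0 : ((P - 1).coeff i : K × Ω).2 = 0 := by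
        have : (P - 1).map ((RingHom.snd K Ω).comp G.subtype) = 0 := by
          rw [Polynomial.map_sub, hP1, Polynomial.map_one, sub_self]
        have hi := congrArg (Polynomial.coeff · i) this
        rwa [Polynomial.coeff_map, Polynomial.coeff_zero] at hi
      have hmem : (((P - 1).coeff i : K × Ω).1, (0 : Ω)) ∈ G := by
        rw [← h0]
        exact ((P - 1).coeff i).2
      exact hIV ⟨⟨_, hA.mpr ⟨_, hmem⟩⟩, hmem, rfl⟩
    have hval : (P - 1).eval₂ ((RingHom.fst K Ω).comp G.subtype) z = -1 := by
      rw [Polynomial.eval₂_sub, hP, Polynomial.eval₂_one, zero_sub]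
    have hlt : V.valuation ((P - 1).eval₂ ((RingHom.fst K Ω).comp G.subtype) z) < 1 := by
      rw [Polynomial.eval₂_eq_sum, Polynomial.sum_def]
      refine Valuation.map_sum_lt _ one_ne_zero fun i _ => ?_
      rw [map_mul, map_pow]
      exact mul_lt_one_of_lt_of_le (hcoeff i)
        (pow_le_one' ((V.valuation_le_one_iff z).mpr hz) i)
    rw [hval, Valuation.map_neg, map_one] at hlt
    exact lt_irrefl _ hlt
  exact (V.mem_or_inv_mem x).imp (key x) (key x⁻¹)

/-- Chevalley's extension theorem: a homomorphism from a subring of `K` to an algebraically closed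
field extends to a place of `K`. -/
theorem exists_place_of_isFunctional [IsAlgClosed Ω] {G : Subring (K × Ω)} (hG : IsFunctional G) :
    ∃ I : Place K Ω, ∀ x y, (x, y) ∈ G → I.toFun x = (y : OnePoint Ω) := by
  classical
  obtain ⟨M, hGM, hM⟩ := exists_maximal_isFunctional hG
  let F : K → OnePoint Ω := fun x =>
    if h : ∃ y, (x, y) ∈ M then ((h.choose : Ω) : OnePoint Ω) else OnePoint.infty
  have hF {x : K} {y : Ω} : F x = (y : OnePoint Ω) ↔ (x, y) ∈ M := by
    constructor
    · intro h
      by_cases hx : ∃ y, (x, y) ∈ M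
      · simp only [F, dif_pos hx, OnePoint.coe_eq_coe] at h
        rw [← h]
        exact hx.choose_spec
      · simp [F, dif_neg hx] at h
    · intro h
      have hx : ∃ y, (x, y) ∈ M := ⟨y, h⟩
      simp only [F, dif_pos hx, OnePoint.coe_eq_coe]
      exact hM.prop.unique hx.choose_spec h
  have hFi {x : K} : F x = OnePoint.infty ↔ ¬ ∃ y, (x, y) ∈ M := by
    by_cases hx : ∃ y, (x, y) ∈ M <;> simp [F, hx]
  refine ⟨⟨F, hF.mpr M.one_mem, ?_, ?_, ?_⟩, fun x y h => hF.mpr (hGM h)⟩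
  · intro x y a b hx hy
    exact hF.mpr (M.add_mem (hF.mp hx) (hF.mp hy))
  · intro x y a b hx hy
    exact hF.mpr (M.mul_mem (hF.mp hx) (hF.mp hy))
  · intro x
    rw [hFi, hF]
    constructor
    · intro h
      refine ⟨?_, ?_⟩
      · rintro rfl
        exact h ⟨0, M.zero_mem⟩
      · obtain ⟨y, hy⟩ := (exists_mem_or_inv_mem_of_maximal hM x).resolve_left h
        by_cases hy0 : y = 0
        · rwa [hy0] at hy
        · have := inv_mem_of_maximal hM hy hy0
          rw [inv_inv] at this
          exact absurd ⟨_, this⟩ h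
    · rintro ⟨hx, h⟩ ⟨y, hy⟩
      have := M.mul_mem hy h
      rw [Prod.mk_mul_mk, mul_inv_cancel₀ hx, mul_zero] at this
      exact zero_ne_one (hM.prop.unique this M.one_mem)

theorem Place.map_inv (I : Place K Ω) {x : K} {y : Ω} (h : I.toFun x = (y : OnePoint Ω))
    (hy : y ≠ 0) : I.toFun x⁻¹ = ((y⁻¹ : Ω) : OnePoint Ω) := by
  have h0 : I.toFun 0 = ((0 : Ω) : OnePoint Ω) := by
    induction h0 : I.toFun 0 using OnePoint.rec with
    | infty => exact absurd rfl ((I.map_infty 0).mp h0).1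
    | coe c =>
      have := I.map_add 0 0 c c h0 h0
      rw [add_zero, h0, OnePoint.coe_eq_coe] at this
      rw [left_eq_add.mp this]
  have hx : x ≠ 0 := by
    rintro rfl
    rw [h0, OnePoint.coe_eq_coe] at h
    exact hy h.symm
  induction h1 : I.toFun x⁻¹ using OnePoint.rec with
  | infty =>
    have := ((I.map_infty x⁻¹).mp h1).2
    rw [inv_inv, h, OnePoint.coe_eq_coe] at this
    exact absurd this hy
  | coe b =>
    have := I.map_mul x x⁻¹ y b h h1
    rw [mul_inv_cancel₀ hx, I.map_one, OnePoint.coe_eq_coe] at this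
    rw [eq_inv_of_mul_eq_one_right this.symm]

end PlaceExtension

/-- An ultrapower of an algebraically closed field is algebraically closed: roots are chosen
coordinatewise. -/
instance isAlgClosed_germ {α k : Type*} (D : Ultrafilter α) [Field k] [IsAlgClosed k] :
    IsAlgClosed (Germ (D : Filter α) k) := by
  refine IsAlgClosed.of_exists_root _ fun P hP hirr => ?_
  have hdeg : 0 < P.natDegree := hirr.natDegree_pos
  have hc (i : ℕ) : ∃ f : α → k, (f : Germ (D : Filter α) k) = P.coeff i :=
    Quotient.exists_rep (P.coeff i)
  choose c hc using hc
  let Q (a : α) : Polynomial k := Polynomial.X ^ P.natDegree +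
    ∑ i ∈ Finset.range P.natDegree, Polynomial.C (c i a) * Polynomial.X ^ i
  have hQ (a : α) : ∃ z, (Q a).IsRoot z := by
    refine IsAlgClosed.exists_root _ fun h => ?_
    have hlt : (∑ i ∈ Finset.range P.natDegree,
        Polynomial.C (c i a) * Polynomial.X ^ i).degree < (P.natDegree : WithBot ℕ) := by
      refine (Polynomial.degree_sum_le _ _).trans_lt ?_
      rw [Finset.sup_lt_iff (WithBot.bot_lt_coe _)]
      intro i hi
      exact (Polynomial.degree_C_mul_X_pow_le _ _).trans_lt
        (by exact_mod_cast Finset.mem_range.mp hi)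
    rw [Polynomial.degree_add_eq_left_of_degree_lt (by simpa using hlt)] at h
    simp only [Polynomial.degree_X_pow, Nat.cast_eq_zero] at h
    omega
  choose r hr using hQ
  refine ⟨(r : Germ (D : Filter α) k), ?_⟩
  rw [Polynomial.eval_eq_sum_range, Finset.sum_range_succ, hP.coeff_natDegree, one_mul, add_comm]
  have hsum : (∑ i ∈ Finset.range P.natDegree, P.coeff i * (r : Germ (D : Filter α) k) ^ i) =
      ((fun a => ∑ i ∈ Finset.range P.natDegree, c i a * r a ^ i : α → k) :
        Germ (D : Filter α) k) := by
    have := map_sum (Germ.coeRingHom (D : Filter α) (R := k))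
      (fun i a => c i a * r a ^ i) (Finset.range P.natDegree)
    simp only [Germ.coe_coeRingHom] at this
    rw [show (fun a => ∑ i ∈ Finset.range P.natDegree, c i a * r a ^ i) =
      ∑ i ∈ Finset.range P.natDegree, (fun a => c i a * r a ^ i) by ext a; simp, this]
    refine Finset.sum_congr rfl fun i _ => ?_
    rw [← hc i]
    rfl
  rw [hsum, ← Germ.coe_pow, ← Germ.coe_add]
  refine congrArg _ (funext fun a => ?_)
  have := hr a
  simp only [Q, Polynomial.IsRoot.def, Polynomial.eval_add, Polynomial.eval_pow,
    Polynomial.eval_X, Polynomial.eval_finsetSum, Polynomial.eval_mul, Polynomial.eval_C] at this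
  exact this

/-! ### Roots of unity modulo almost all primes -/

section FixedLevel

theorem eventually_intCast_ne_zero {D : Ultrafilter Nat.Primes}
    (hD : (D : Filter Nat.Primes) ≤ cofinite) {c : ℤ} (hc : c ≠ 0) :
    ∀ᶠ p : Nat.Primes in (D : Filter Nat.Primes), (c : ZMod p) ≠ 0 := by
  refine hD (Filter.mem_cofinite.mpr ?_)
  have hfin : (c.natAbs.divisors : Set ℕ).Finite := Finset.finite_toSet _
  refine (hfin.preimage Nat.Primes.coe_nat_injective.injOn).subset fun p hp => ?_
  have h0 : (c : ZMod p) = 0 := not_not.mp hp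
  rw [ZMod.intCast_zmod_eq_zero_iff_dvd] at h0
  simpa [hc] using Int.natCast_dvd.mp h0

theorem eventually_le_prime {D : Ultrafilter Nat.Primes}
    (hD : (D : Filter Nat.Primes) ≤ cofinite) (n : ℕ) :
    ∀ᶠ p : Nat.Primes in (D : Filter Nat.Primes), n ≤ (p : ℕ) := by
  refine hD (Filter.mem_cofinite.mpr ?_)
  refine ((Set.finite_lt_nat n).preimage Nat.Primes.coe_nat_injective.injOn).subset fun p hp => ?_
  exact not_le.mp (show ¬ n ≤ (p : ℕ) from hp)

/-- If an integral polynomial does not vanish at a complex primitive `N`-th root of unity, then it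
vanishes at a primitive `N`-th root of unity of a domain only if the characteristic divides a fixed
nonzero integer: the constant term of the minimal polynomial of its complex value. -/
theorem exists_int_of_aeval_ne_zero {N : ℕ} (hN : 0 < N) {ζ : ℂ} (hζ : IsPrimitiveRoot ζ N)
    {q : Polynomial ℤ} (hq : Polynomial.aeval ζ q ≠ 0) :
    ∃ c : ℤ, c ≠ 0 ∧ ∀ (p : Nat.Primes) (z : ZMod p), IsPrimitiveRoot z N →
      Polynomial.aeval z q = 0 → (c : ZMod p) = 0 := by
  have hint : IsIntegral ℤ (Polynomial.aeval ζ q) :=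
    adjoin_le_integralClosure (hζ.isIntegral hN) (Polynomial.aeval_mem_adjoin_singleton ℤ ζ)
  have hc : (minpoly ℤ (Polynomial.aeval ζ q)).coeff 0 ≠ 0 := by
    have h := minpoly.coeff_zero_ne_zero (A := ℚ) hint.tower_top hq
    rw [minpoly.isIntegrallyClosed_eq_field_fractions' ℚ hint, Polynomial.coeff_map] at h
    exact fun h0 => h (by rw [h0, map_zero])
  refine ⟨_, hc, ?_⟩
  intro p z hz hqz
  -- The minimal polynomial composed with `q` vanishes at `ζ`, hence is divisible by the cyclotomic
  -- polynomial, hence vanishes at `z`.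
  have hdvd : Polynomial.cyclotomic N ℤ ∣ (minpoly ℤ (Polynomial.aeval ζ q)).comp q := by
    rw [Polynomial.cyclotomic_eq_minpoly hζ hN]
    refine minpoly.isIntegrallyClosed_dvd (hζ.isIntegral hN) ?_
    rw [Polynomial.aeval_comp, minpoly.aeval]
  obtain ⟨r, hr⟩ := hdvd
  have hcyc : Polynomial.aeval z (Polynomial.cyclotomic N ℤ) = 0 := by
    rw [Polynomial.aeval_def, Polynomial.eval₂_eq_eval_map, algebraMap_int_eq,
      Polynomial.map_cyclotomic]
    exact hz.isRoot_cyclotomic hN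
  have h0 : Polynomial.aeval z ((minpoly ℤ (Polynomial.aeval ζ q)).comp q) = 0 := by
    rw [hr, map_mul, hcyc, zero_mul]
  rw [Polynomial.aeval_comp, hqz, Polynomial.aeval_def, Polynomial.eval₂_at_zero] at h0
  simpa using h0

theorem exists_isPrimitiveRoot (p : ℕ) [Fact p.Prime] :
    ∃ ε : ZMod p, IsPrimitiveRoot ε (p - 1) := by
  obtain ⟨g, hg⟩ := IsCyclic.exists_generator (α := (ZMod p)ˣ)
  refine ⟨g, IsPrimitiveRoot.coe_units_iff.mpr ?_⟩
  have := orderOf_eq_card_of_forall_mem_zpowers hg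
  rw [Nat.card_eq_fintype_card, ZMod.card_units] at this
  rw [← this]
  exact IsPrimitiveRoot.orderOf g

theorem IsPrimitiveRoot.pow_div {M : Type*} [CommMonoid M] {ε : M} {n m : ℕ} (hn : 0 < n)
    (hε : IsPrimitiveRoot ε n) (hm : m ∣ n) : IsPrimitiveRoot (ε ^ (n / m)) m :=
  hε.pow hn (Nat.div_mul_cancel hm).symm

/-- Every primitive root of unity in `ZMod p` is the appropriate power of some primitive root
modulo `p`, because units modulo `m` lift to units modulo `p - 1`. -/
theorem exists_isPrimitiveRoot_pow_eq {p : ℕ} [hp : Fact p.Prime] {m : ℕ} (hm : m ∣ p - 1)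
    {θ : ZMod p} (hθ : IsPrimitiveRoot θ m) :
    ∃ ε : ZMod p, IsPrimitiveRoot ε (p - 1) ∧ ε ^ ((p - 1) / m) = θ := by
  have hp1 : 0 < p - 1 := Nat.sub_pos_of_lt hp.out.one_lt
  have : NeZero (p - 1) := ⟨hp1.ne'⟩
  have : NeZero m := ⟨fun h => hp1.ne' (by simpa [h] using hm)⟩
  obtain ⟨ε, hε⟩ := exists_isPrimitiveRoot p
  have hεm := IsPrimitiveRoot.pow_div hp1 hε hm
  obtain ⟨i, -, hi, hiθ⟩ := (hεm.isPrimitiveRoot_iff).mp hθ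
  obtain ⟨u, hu⟩ := ZMod.unitsMap_surjective hm (ZMod.unitOfCoprime i hi)
  refine ⟨ε ^ (u : ZMod (p - 1)).val, hε.pow_of_coprime _ (ZMod.val_coe_unit_coprime u), ?_⟩
  rw [← pow_mul, mul_comm, pow_mul, ← hiθ]
  refine pow_eq_pow_of_modEq ((ZMod.natCast_eq_natCast_iff _ _ _).mp ?_) hεm.pow_eq_one
  have := congrArg (fun v : (ZMod m)ˣ => (v : ZMod m)) hu
  simp only [ZMod.unitsMap_val, ZMod.coe_unitOfCoprime] at this
  rw [← this, ZMod.natCast_val]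

/-- A primitive `N`-th root of unity `ζ` has `ι` distinct primitive `ι ^ 2`-th roots of the form
`θ ^ (1 + N * ι * t)`, so one of them avoids any given set with fewer than `ι` elements. -/
theorem exists_isPrimitiveRoot_pow_notMem {p : ℕ} [hp : Fact p.Prime] {N ι : ℕ} (hN : 1 < N)
    (hι : 0 < ι) (hdvd : N * ι ^ 2 ∣ p - 1) {ζ : ZMod p} (hζ : IsPrimitiveRoot ζ N)
    (S : Finset (ZMod p)) (hS : S.card < ι) :
    ∃ ε : ZMod p, IsPrimitiveRoot ε (p - 1) ∧ ε ^ ((p - 1) / N) = ζ ∧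
      ε ^ ((p - 1) / (N * ι ^ 2)) ∉ S := by
  have hp1 : 0 < p - 1 := Nat.sub_pos_of_lt hp.out.one_lt
  have hdiv : (p - 1) / N = (p - 1) / (N * ι ^ 2) * ι ^ 2 := by
    obtain ⟨d, hd⟩ := hdvd
    have h1 : (p - 1) / N = ι ^ 2 * d := by
      rw [hd, mul_assoc, Nat.mul_div_cancel_left _ (by omega)]
    have h2 : (p - 1) / (N * ι ^ 2) = d := by
      rw [hd, Nat.mul_div_cancel_left _ (by positivity)]
    rw [h1, h2, mul_comm]
  obtain ⟨ε₁, hε₁, hεζ⟩ := exists_isPrimitiveRoot_pow_eq ((dvd_mul_right N _).trans hdvd) hζ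
  set θ := ε₁ ^ ((p - 1) / (N * ι ^ 2)) with hθdef
  have hθ : IsPrimitiveRoot θ (N * ι ^ 2) := IsPrimitiveRoot.pow_div hp1 hε₁ hdvd
  have hθζ : θ ^ ι ^ 2 = ζ := by rw [hθdef, ← pow_mul, ← hdiv, hεζ]
  have hlt (t : ℕ) (ht : t < ι) : 1 + N * ι * t < N * ι ^ 2 := by
    have h1 : N * ι * (t + 1) ≤ N * ι * ι := Nat.mul_le_mul_left _ ht
    have h2 : 1 * 1 < N * ι := by nlinarith
    nlinarith
  have hinj : Set.InjOn (fun t => θ ^ (1 + N * ι * t)) (Finset.range ι : Finset ℕ) := by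
    intro t ht t' ht' h
    have := hθ.pow_inj (hlt t (by simpa using ht)) (hlt t' (by simpa using ht')) h
    have hpos : 0 < N * ι := by positivity
    exact Nat.eq_of_mul_eq_mul_left hpos (by omega)
  obtain ⟨x, hx, hxS⟩ := Finset.exists_mem_notMem_of_card_lt_card
    (s := S) (t := (Finset.range ι).image fun t => θ ^ (1 + N * ι * t))
    (by rwa [Finset.card_image_of_injOn hinj, Finset.card_range])
  obtain ⟨t, -, rfl⟩ := Finset.mem_image.mp hx
  -- The exponent is congruent to `1` modulo every prime factor of `N * ι ^ 2`.
  have hcop : (1 + N * ι * t).Coprime (N * ι ^ 2) := by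
    have h (m : ℕ) (hm : m ∣ N * ι * t) : (1 + N * ι * t).Coprime m := by
      obtain ⟨d, hd⟩ := hm
      rw [hd]
      simp
    exact (h N ⟨ι * t, by ring⟩).mul_right ((h ι ⟨N * t, by ring⟩).pow_right 2)
  obtain ⟨ε, hε, hεθ⟩ := exists_isPrimitiveRoot_pow_eq hdvd (hθ.pow_of_coprime _ hcop)
  refine ⟨ε, hε, ?_, by rwa [hεθ]⟩
  rw [hdiv, pow_mul, hεθ, ← pow_mul,
    show (1 + N * ι * t) * ι ^ 2 = ι ^ 2 + N * ι ^ 2 * (ι * t) by ring, pow_add,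
    pow_mul θ (N * ι ^ 2), hθ.pow_eq_one, one_pow, mul_one, hθζ]

/-- Integral polynomials in three variables: an integer `ι`, a root of unity `ζ` and a root of unity
`θ` of much larger order, from the innermost variable to the outermost one. -/
abbrev RelPoly : Type := Polynomial (Polynomial (Polynomial ℤ))

/-- Evaluation of the coefficients of a `RelPoly`. -/
noncomputable def evalCoeff {R : Type*} [CommRing R] (i z : R) :
    Polynomial (Polynomial ℤ) →+* R :=
  Polynomial.eval₂RingHom (Polynomial.eval₂RingHom (Int.castRingHom R) i) z

/-- Evaluation of a `RelPoly`. -/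
noncomputable def evalRel {R : Type*} [CommRing R] (i z y : R) : RelPoly →+* R :=
  Polynomial.eval₂RingHom (evalCoeff i z) y

theorem evalRel_C {R : Type*} [CommRing R] (i z y : R) (h : Polynomial (Polynomial ℤ)) :
    evalRel i z y (Polynomial.C h) = evalCoeff i z h :=
  Polynomial.eval₂_C _ _

theorem evalRel_neg {R : Type*} [CommRing R] (i z y : R) (g : RelPoly) :
    evalRel i z y (-g) = -evalRel i z y g :=
  Polynomial.eval₂_neg _

theorem map_evalCoeff {R S : Type*} [CommRing R] [CommRing S] (f : R →+* S) (i z : R)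
    (h : Polynomial (Polynomial ℤ)) : f (evalCoeff i z h) = evalCoeff (f i) (f z) h := by
  have : f.comp (evalCoeff i z) = evalCoeff (f i) (f z) := by
    refine Polynomial.ringHom_ext' (Polynomial.ringHom_ext' (RingHom.ext_int _ _) ?_) ?_ <;>
      simp [evalCoeff]
  exact congrArg (fun g : Polynomial (Polynomial ℤ) →+* S => g h) this

theorem evalRel_eq_zero_of_coeff {R : Type*} [CommRing R] {i z y : R} {g : RelPoly}
    (h : ∀ v, evalCoeff i z (g.coeff v) = 0) : evalRel i z y g = 0 := by
  simp [evalRel, Polynomial.eval₂_eq_sum, Polynomial.sum_def, h]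

/-- For finitely many polynomials and large `ι`, the primitive root modulo `p` can be chosen with
prescribed `ζ` in such a way that `θ` is a root only of those polynomials whose coefficients vanish
at `ι` and `ζ`. -/
theorem exists_generic_isPrimitiveRoot {p : ℕ} [hp : Fact p.Prime] {N ι : ℕ} (hN : 1 < N)
    (hdvd : N * ι ^ 2 ∣ p - 1) {ζ : ZMod p} (hζ : IsPrimitiveRoot ζ N) (B : Finset RelPoly)
    (hB : ∑ g ∈ B, g.natDegree < ι) :
    ∃ ε : ZMod p, IsPrimitiveRoot ε (p - 1) ∧ ε ^ ((p - 1) / N) = ζ ∧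
      ∀ g ∈ B, evalRel (ι : ZMod p) ζ (ε ^ ((p - 1) / (N * ι ^ 2))) g = 0 →
        ∀ v, evalCoeff (ι : ZMod p) ζ (g.coeff v) = 0 := by
  classical
  obtain ⟨ε, hε, hεζ, hεS⟩ := exists_isPrimitiveRoot_pow_notMem hN (by omega) hdvd hζ
    (B.biUnion fun g => (g.map (evalCoeff (ι : ZMod p) ζ)).roots.toFinset) (by
      refine (Finset.card_biUnion_le.trans (Finset.sum_le_sum fun g _ => ?_)).trans_lt hB
      exact (Multiset.toFinset_card_le _).trans
        ((Polynomial.card_roots' _).trans Polynomial.natDegree_map_le))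
  refine ⟨ε, hε, hεζ, fun g hg h0 v => ?_⟩
  by_contra hv
  refine hεS (Finset.mem_biUnion.mpr ⟨g, hg, ?_⟩)
  rw [Multiset.mem_toFinset, Polynomial.mem_roots', Polynomial.IsRoot.def, Polynomial.eval_map]
  refine ⟨fun hz => hv ?_, h0⟩
  rw [← Polynomial.coeff_map, hz, Polynomial.coeff_zero]

/-- For a large constant `ι` and almost all `p`, some primitive root modulo `p` satisfies only those
of finitely many relations that hold over `ℂ` identically in `ι` and `θ`. -/
theorem eventually_generic_of_large {D : Ultrafilter Nat.Primes}
    (hD : (D : Filter Nat.Primes) ≤ cofinite) {N : ℕ} (hN : 1 < N) {ζ : ℂ}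
    (hζ : IsPrimitiveRoot ζ N) (B : Finset RelPoly) :
    ∃ ι₀ : ℕ, ∀ ι : ℕ, ι₀ ≤ ι → ∀ᶠ p : Nat.Primes in (D : Filter Nat.Primes),
      N * ι ^ 2 ∣ (p : ℕ) - 1 → ∃ ε : ZMod p, IsPrimitiveRoot ε ((p : ℕ) - 1) ∧
        ∀ g ∈ B, evalRel (ι : ZMod p) (ε ^ (((p : ℕ) - 1) / N))
          (ε ^ (((p : ℕ) - 1) / (N * ι ^ 2))) g = 0 → ∀ w y : ℂ, evalRel w ζ y g = 0 := by
  classical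
  -- The coefficient `h` as a polynomial in `ι` over `ℂ`, with the complex value of `ζ` inserted.
  let H (h : Polynomial (Polynomial ℤ)) : Polynomial ℂ :=
    evalCoeff Polynomial.X (Polynomial.C ζ) h
  have hH (h) (w : ℂ) : (H h).eval w = evalCoeff w ζ h := by
    have := map_evalCoeff (Polynomial.evalRingHom w) Polynomial.X (Polynomial.C ζ) h
    simpa [H] using this
  let Co : Finset (Polynomial (Polynomial ℤ)) := B.biUnion fun g => g.support.image g.coeff
  have hfin : (⋃ h ∈ Co, {n : ℕ | (n : ℂ) ∈ (H h).roots}).Finite := by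
    refine Co.finite_toSet.biUnion fun h _ => ?_
    have := ((H h).roots.toFinset.finite_toSet).preimage
      (Nat.cast_injective (R := ℂ)).injOn
    exact this.subset fun n hn => Multiset.mem_toFinset.mpr hn
  obtain ⟨n₀, hn₀⟩ := hfin.bddAbove
  refine ⟨max (n₀ + 1) (∑ g ∈ B, g.natDegree + 1), fun ι hι => ?_⟩
  have hroot (h) (hh : h ∈ Co) (h0 : evalCoeff (ι : ℂ) ζ h = 0) : H h = 0 := by
    by_contra hne
    have := hn₀ (Set.mem_biUnion hh (show (ι : ℂ) ∈ (H h).roots by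
      rw [Polynomial.mem_roots hne, Polynomial.IsRoot.def, hH, h0]))
    omega
  have htrans : ∀ h ∈ Co, ∀ᶠ p : Nat.Primes in (D : Filter Nat.Primes), ∀ z : ZMod p,
      IsPrimitiveRoot z N → evalCoeff (ι : ZMod p) z h = 0 → evalCoeff (ι : ℂ) ζ h = 0 := by
    intro h _
    by_cases h0 : evalCoeff (ι : ℂ) ζ h = 0
    · exact Eventually.of_forall fun _ _ _ _ => h0
    · -- For a constant `ι`, the relation is an integral polynomial in `ζ` alone.
      let q : Polynomial ℤ := evalCoeff (Polynomial.C (ι : ℤ)) Polynomial.X h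
      have hq {R : Type} [CommRing R] (z : R) : Polynomial.aeval z q = evalCoeff (ι : R) z h := by
        have := map_evalCoeff ((Polynomial.aeval z : Polynomial ℤ →ₐ[ℤ] R) : Polynomial ℤ →+* R)
          (Polynomial.C (ι : ℤ)) Polynomial.X h
        simpa [q] using this
      rw [← hq] at h0
      obtain ⟨c, hc, hcp⟩ := exists_int_of_aeval_ne_zero (by omega) hζ h0
      filter_upwards [eventually_intCast_ne_zero hD hc] with p hp z hz hzero
      exact absurd (hcp p z hz (by rw [hq, hzero])) hp
  filter_upwards [(Filter.eventually_all_finset Co).mpr htrans] with p hp hdvd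
  have hp1 : 0 < (p : ℕ) - 1 := Nat.sub_pos_of_lt p.2.one_lt
  obtain ⟨ε₀, hε₀⟩ := exists_isPrimitiveRoot (p : ℕ)
  have hζp := IsPrimitiveRoot.pow_div hp1 hε₀ ((dvd_mul_right N _).trans hdvd)
  obtain ⟨ε, hε, hεζ, hεB⟩ := exists_generic_isPrimitiveRoot hN hdvd hζp B (by omega)
  refine ⟨ε, hε, fun g hg h0 w y => evalRel_eq_zero_of_coeff fun v => ?_⟩
  rw [hεζ] at h0
  by_cases hv : g.coeff v = 0
  · rw [hv, map_zero]
  · have hmem : g.coeff v ∈ Co := Finset.mem_biUnion.mpr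
      ⟨g, hg, Finset.mem_image_of_mem _ (Polynomial.mem_support_iff.mpr hv)⟩
    rw [← hH, hroot _ hmem (hp _ hmem _ hζp (hεB g hg h0 v)), Polynomial.eval_zero]

/-- For almost all primes `p` of the form `ι ^ 4 + 1`, some primitive root modulo `p` satisfies only
those of finitely many relations that hold over `ℂ` identically in `θ`, where `ι` is replaced by
the power of the complex number `ζ` that is a primitive eighth root of unity. -/
theorem eventually_generic_of_pow_four_add_one {D : Ultrafilter Nat.Primes}
    (hD : (D : Filter Nat.Primes) ≤ cofinite) {N : ℕ} (hN : 0 < N) (hN8 : 8 ∣ N) {ζ : ℂ}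
    (hζ : IsPrimitiveRoot ζ N) (B : Finset RelPoly) :
    ∀ᶠ p : Nat.Primes in (D : Filter Nat.Primes), ∀ ι : ℕ, ι ^ 4 + 1 = (p : ℕ) →
      ∑ g ∈ B, g.natDegree < ι → N * ι ^ 2 ∣ (p : ℕ) - 1 →
        ∃ ε : ZMod p, IsPrimitiveRoot ε ((p : ℕ) - 1) ∧
        ∀ g ∈ B, evalRel (ι : ZMod p) (ε ^ (((p : ℕ) - 1) / N))
          (ε ^ (((p : ℕ) - 1) / (N * ι ^ 2))) g = 0 → ∀ y : ℂ, evalRel (ζ ^ (N / 8)) ζ y g = 0 := by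
  classical
  let Co : Finset (Polynomial (Polynomial ℤ)) := B.biUnion fun g => g.support.image g.coeff
  have htrans : ∀ h ∈ Co, ∀ᶠ p : Nat.Primes in (D : Filter Nat.Primes), ∀ z : ZMod p,
      IsPrimitiveRoot z N → evalCoeff (z ^ (N / 8)) z h = 0 →
        evalCoeff (ζ ^ (N / 8)) ζ h = 0 := by
    intro h _
    by_cases h0 : evalCoeff (ζ ^ (N / 8)) ζ h = 0
    · exact Eventually.of_forall fun _ _ _ _ => h0
    · -- As `ι` is a power of `ζ`, the relation is an integral polynomial in `ζ` alone.
      let q : Polynomial ℤ := evalCoeff (Polynomial.X ^ (N / 8)) Polynomial.X h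
      have hq {R : Type} [CommRing R] (z : R) :
          Polynomial.aeval z q = evalCoeff (z ^ (N / 8)) z h := by
        have := map_evalCoeff ((Polynomial.aeval z : Polynomial ℤ →ₐ[ℤ] R) : Polynomial ℤ →+* R)
          (Polynomial.X ^ (N / 8)) Polynomial.X h
        simpa [q] using this
      rw [← hq] at h0
      obtain ⟨c, hc, hcp⟩ := exists_int_of_aeval_ne_zero hN hζ h0
      filter_upwards [eventually_intCast_ne_zero hD hc] with p hp z hz hzero
      exact absurd (hcp p z hz (by rw [hq, hzero])) hp
  filter_upwards [(Filter.eventually_all_finset Co).mpr htrans, eventually_le_prime hD 3]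
    with p hp hp3 ι hιp hι hdvd
  have hp1 : 0 < (p : ℕ) - 1 := Nat.sub_pos_of_lt p.2.one_lt
  have hNdvd : N ∣ (p : ℕ) - 1 := (dvd_mul_right N _).trans hdvd
  have h4 : (ι : ZMod p) ^ 4 = -1 := by
    have := congrArg (Nat.cast (R := ZMod p)) hιp
    push_cast at this
    rw [ZMod.natCast_self] at this
    linear_combination this
  have h8 : IsPrimitiveRoot (ι : ZMod p) 8 := by
    have : Fact (2 < (p : ℕ)) := ⟨hp3⟩
    have := orderOf_eq_prime_pow (p := 2) (n := 2) (x := (ι : ZMod p))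
      (by norm_num [h4, ZMod.neg_one_ne_one])
      (by norm_num; rw [show (8 : ℕ) = 4 * 2 by norm_num, pow_mul, h4]; norm_num)
    exact IsPrimitiveRoot.iff_orderOf.mpr this
  obtain ⟨ε₀, hε₀, hε₀ι⟩ := exists_isPrimitiveRoot_pow_eq (hN8.trans hNdvd) h8
  have hζp := IsPrimitiveRoot.pow_div hp1 hε₀ hNdvd
  have hζι : (ε₀ ^ (((p : ℕ) - 1) / N)) ^ (N / 8) = (ι : ZMod p) := by
    rw [← pow_mul, Nat.div_mul_div_comm hNdvd hN8, mul_comm N 8, Nat.mul_div_mul_right _ _ hN,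
      hε₀ι]
  obtain ⟨ε, hε, hεζ, hεB⟩ := exists_generic_isPrimitiveRoot
    (by have := Nat.le_of_dvd hN hN8; omega) hdvd hζp B hι
  refine ⟨ε, hε, fun g hg h0 y => evalRel_eq_zero_of_coeff fun v => ?_⟩
  rw [hεζ] at h0
  by_cases hv : g.coeff v = 0
  · rw [hv, map_zero]
  · have hmem : g.coeff v ∈ Co := Finset.mem_biUnion.mpr
      ⟨g, hg, Finset.mem_image_of_mem _ (Polynomial.mem_support_iff.mpr hv)⟩
    refine hp _ hmem _ hζp ?_
    rw [hζι]
    exact hεB g hg h0 v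

end FixedLevel

/-! ### Generic primitive roots at a given level -/

section Levels

open scoped Nat

/-- The order of the root of unity `ζ` at level `k`: this is `2 * 𝔩 ^ 2` with `𝔩 = (k !) ^ 2`. The
second factor `𝔩` absorbs the denominators of the rational coefficients in the exponents. -/
def rootOrder (k : ℕ) : ℕ := 2 * (k !) ^ 4

/-- The complex value of `ζ` at level `k`. -/
noncomputable def rootValue (k : ℕ) : ℂ :=
  Complex.exp (-(2 * Real.pi * Complex.I / rootOrder k))

/-- The complex value of `θ` at level `k`. -/
noncomputable def realValue (k : ℕ) : ℂ :=
  Complex.exp (-(2 * Real.pi / rootOrder k))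

theorem one_lt_rootOrder (k : ℕ) : 1 < rootOrder k := by
  have := Nat.pow_pos (n := 4) (Nat.factorial_pos k)
  unfold rootOrder
  omega

theorem isPrimitiveRoot_rootValue (k : ℕ) : IsPrimitiveRoot (rootValue k) (rootOrder k) := by
  have h0 : rootOrder k ≠ 0 := by have := one_lt_rootOrder k; omega
  rw [rootValue, Complex.exp_neg]
  exact (Complex.isPrimitiveRoot_exp _ h0).inv

theorem eight_dvd_rootOrder {k : ℕ} (hk : 2 ≤ k) : 8 ∣ rootOrder k := by
  obtain ⟨d, hd⟩ := Nat.dvd_factorial two_pos hk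
  exact ⟨4 * d ^ 4, by rw [rootOrder, hd]; ring⟩

theorem rootValue_pow_div_eight {k : ℕ} (hk : 2 ≤ k) :
    rootValue k ^ (rootOrder k / 8) = Complex.exp (-(Real.pi * Complex.I / 4)) := by
  obtain ⟨d, hd⟩ := eight_dvd_rootOrder hk
  have h0 : rootOrder k ≠ 0 := by have := one_lt_rootOrder k; omega
  have hd0 : (d : ℂ) ≠ 0 := by
    rintro h
    simp_all
  rw [rootValue, hd, Nat.mul_div_cancel_left _ (by norm_num), ← Complex.exp_nat_mul]
  congr 1
  push_cast
  field_simp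
  norm_num

/-- The basic relation polynomials at level `k`: `0`, `1`, the constant `μ = k !`, the variable
`ι`, and the powers of `ζ` and `θ` with exponents up to `k * 𝔩 ^ 2`. -/
def levelGenerators (k : ℕ) : Set RelPoly :=
  {0, 1, Polynomial.C (Polynomial.C (Polynomial.C ((k ! : ℕ) : ℤ))),
    Polynomial.C (Polynomial.C Polynomial.X)} ∪
  ((fun u : ℕ => Polynomial.C (Polynomial.X ^ u)) '' Set.Iic (k * (k !) ^ 4) ∪
    (fun u : ℕ => Polynomial.X ^ u) '' Set.Iic (k * (k !) ^ 4))

/-- The relation polynomials obtained from the basic ones at level `k` by at most `n` nested rounds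
of additions, multiplications and negations. -/
def levelFiltration (k : ℕ) : ℕ → Set RelPoly
  | 0 => levelGenerators k
  | n + 1 => Set.image2 (· + ·) (levelFiltration k n) (levelFiltration k n) ∪
      (Set.image2 (· * ·) (levelFiltration k n) (levelFiltration k n) ∪
        (fun g => -g) '' levelFiltration k n)

theorem finite_levelFiltration (k n : ℕ) : (levelFiltration k n).Finite := by
  induction n with
  | zero =>
    refine Set.Finite.union (by simp) (Set.Finite.union ?_ ?_) <;>
      exact (Set.finite_Iic _).image _
  | succ n ih => exact (ih.image2 _ ih).union ((ih.image2 _ ih).union (ih.image _))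

theorem levelFiltration_mono (k : ℕ) : Monotone (levelFiltration k) := by
  have h0 (n : ℕ) : (0 : RelPoly) ∈ levelFiltration k n := by
    induction n with
    | zero => simp [levelFiltration, levelGenerators]
    | succ n ih => exact Or.inl ⟨0, ih, 0, ih, by simp⟩
  exact monotone_nat_of_le_succ fun n g hg => Or.inl ⟨g, hg, 0, h0 n, by simp⟩

/-- The requirements, at a prime `p`, for `ι` and the primitive root `ε` to behave generically up to
level `k`. The set `W` contains the complex values that `ι` may be sent to. -/
structure IsGeneric (k : ℕ) (p : Nat.Primes) (ι : ℕ) (ε : ZMod p) (W : Set ℂ) : Prop where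
  dvd : k ! * (rootOrder k * ι ^ 2) ∣ (p : ℕ) - 1
  growth : ((k ! ^ 2) ^ k) < ι ^ 2
  prim : IsPrimitiveRoot ε ((p : ℕ) - 1)
  eval : ∀ g ∈ levelFiltration k k, evalRel (ι : ZMod p) (ε ^ (((p : ℕ) - 1) / rootOrder k))
    (ε ^ (((p : ℕ) - 1) / (rootOrder k * ι ^ 2))) g = 0 →
      ∀ w ∈ W, evalRel w (rootValue k) (realValue k) g = 0

/-- For a fixed level, almost all primes admit a generic primitive root for every possible value of
`ι`, where `ι` itself is a large constant. -/
theorem exists_eventually_isGeneric_univ {D : Ultrafilter Nat.Primes}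
    (hD : (D : Filter Nat.Primes) ≤ cofinite)
    (hdiv : ∀ m : ℕ, 0 < m → ∀ᶠ p : Nat.Primes in (D : Filter Nat.Primes), m ∣ (p : ℕ) - 1)
    (k : ℕ) :
    ∃ ι : ℕ, ∀ᶠ p : Nat.Primes in (D : Filter Nat.Primes),
      ∃ ε : ZMod p, IsGeneric k p ι ε Set.univ := by
  obtain ⟨ι₀, hι₀⟩ := eventually_generic_of_large hD (one_lt_rootOrder k)
    (isPrimitiveRoot_rootValue k) (finite_levelFiltration k k).toFinset
  have hpos : 0 < ι₀ + (k ! ^ 2) ^ k + 1 := by omega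
  refine ⟨ι₀ + (k ! ^ 2) ^ k + 1, ?_⟩
  filter_upwards [hι₀ (ι₀ + (k ! ^ 2) ^ k + 1) (by omega),
    hdiv (k ! * (rootOrder k * (ι₀ + (k ! ^ 2) ^ k + 1) ^ 2))
      (by have := one_lt_rootOrder k; have := Nat.factorial_pos k; positivity)] with p hp hpd
  obtain ⟨ε, hε, hB⟩ := hp ((dvd_mul_left _ _).trans hpd)
  refine ⟨ε, hpd, ?_, hε, fun g hg h0 w _ => hB g (by simpa using hg) h0 w _⟩
  nlinarith

/-- For a fixed level, almost all primes of the form `ι ^ 4 + 1` admit a generic primitive root that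
sends `ι` to the appropriate eighth root of unity. -/
theorem eventually_exists_isGeneric {D : Ultrafilter Nat.Primes}
    (hD : (D : Filter Nat.Primes) ≤ cofinite)
    (hdiv : ∀ m : ℕ, 0 < m → ∀ᶠ p : Nat.Primes in (D : Filter Nat.Primes), m ∣ (p : ℕ) - 1)
    {ι : Nat.Primes → ℕ}
    (hι : ∀ᶠ p : Nat.Primes in (D : Filter Nat.Primes), ι p ^ 4 + 1 = (p : ℕ))
    {k : ℕ} (hk : 2 ≤ k) :
    ∀ᶠ p : Nat.Primes in (D : Filter Nat.Primes),
      ∃ ε : ZMod p, IsGeneric k p (ι p) ε {Complex.exp (-(Real.pi * Complex.I / 4))} := by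
  have hN := one_lt_rootOrder k
  have hk0 := Nat.factorial_pos k
  set s := ∑ g ∈ (finite_levelFiltration k k).toFinset, g.natDegree with hs
  have hlarge : ∀ᶠ p : Nat.Primes in (D : Filter Nat.Primes), s + (k ! ^ 2) ^ k < ι p := by
    filter_upwards [hι, eventually_le_prime hD ((s + (k ! ^ 2) ^ k) ^ 4 + 2)] with p hp hle
    exact lt_of_pow_lt_pow_left₀ 4 (Nat.zero_le _) (by omega)
  filter_upwards [hι, hlarge, hdiv ((k ! * rootOrder k) ^ 4) (by positivity),
    eventually_generic_of_pow_four_add_one hD (by omega) (eight_dvd_rootOrder hk)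
      (isPrimitiveRoot_rootValue k) (finite_levelFiltration k k).toFinset]
    with p hp hpl hpd hpg
  have hp4 : (p : ℕ) - 1 = ι p ^ 4 := by omega
  -- `p - 1` is the fourth power of `ι p`, so divisibility of `p - 1` by fourth powers makes `ι p`
  -- highly divisible.
  have hdvd : k ! * (rootOrder k * ι p ^ 2) ∣ (p : ℕ) - 1 := by
    rw [hp4, Nat.pow_dvd_pow_iff (by norm_num)] at hpd
    rw [hp4, ← mul_assoc, show ι p ^ 4 = ι p ^ 2 * ι p ^ 2 by ring]
    exact Nat.mul_dvd_mul (hpd.trans (dvd_pow_self _ two_ne_zero)) dvd_rfl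
  obtain ⟨ε, hε, hB⟩ := hpg (ι p) hp (by omega) ((dvd_mul_left _ _).trans hdvd)
  refine ⟨ε, hdvd, ?_, hε, ?_⟩
  · nlinarith
  · rintro g hg h0 w rfl
    rw [← rootValue_pow_div_eight hk]
    exact hB g (by simpa using hg) h0 _

/-- A sequence of properties that hold almost everywhere holds almost everywhere at a level that
tends to infinity. -/
theorem exists_level {D : Ultrafilter Nat.Primes} (hD : (D : Filter Nat.Primes) ≤ cofinite)
    {Q : ℕ → Nat.Primes → Prop}
    (hQ : ∀ k, 2 ≤ k → ∀ᶠ p : Nat.Primes in (D : Filter Nat.Primes), Q k p) :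
    ∃ κ : Nat.Primes → ℕ, (∀ n, ∀ᶠ p : Nat.Primes in (D : Filter Nat.Primes), n ≤ κ p) ∧
      ∀ᶠ p : Nat.Primes in (D : Filter Nat.Primes), Q (κ p) p := by
  classical
  refine ⟨fun p => Nat.findGreatest (fun k => Q k p) p, fun n => ?_, ?_⟩
  · filter_upwards [hQ (max n 2) (le_max_right _ _), eventually_le_prime hD (max n 2)] with p h1 h2
    exact (le_max_left n 2).trans (Nat.le_findGreatest h2 h1)
  · filter_upwards [hQ 2 le_rfl, eventually_le_prime hD 2] with p h1 h2
    exact Nat.findGreatest_spec (P := fun k => Q k p) h2 h1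

end Levels

/-! ### Transcendence and algebraic independence -/

section Algebra

variable {K : Type*} [Field K]

/-- An element that is transcendental over a domain stays transcendental over the field generated by
an algebraic element. -/
theorem transcendental_closure_singleton {R : Type*} [CommRing R] [IsDomain R] [Algebra R K]
    {x m : K} (hm : Transcendental R m) (hx : IsAlgebraic R x) :
    Transcendental (Subfield.closure {x}) m := by
  intro halg
  -- Everything in the field is algebraic over `R`, so algebraicity of `m` descends to `R`.
  let A := Subalgebra.algebraicClosure R K
  have hA {z : K} : z ∈ A ↔ IsAlgebraic R z := Iff.rfl
  have hle (z : K) (hz : z ∈ Subfield.closure {x}) : z ∈ A := by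
    induction hz using Subfield.closure_induction with
    | mem z hz => exact (Set.mem_singleton_iff.mp hz) ▸ hx
    | one => exact A.one_mem
    | add _ _ _ _ ha hb => exact A.add_mem ha hb
    | neg _ _ ha => exact A.neg_mem ha
    | inv _ _ ha => exact IsAlgebraic.inv ha
    | mul _ _ _ _ ha hb => exact A.mul_mem ha hb
  let f : Subfield.closure {x} →+* A :=
    (Subfield.closure {x}).subtype.codRestrict A fun z => hle z z.2
  have hmA : IsAlgebraic A m := by
    refine halg.ringHom_of_comp_eq f (RingHom.id K) ?_ rfl
    intro a b hab
    exact Subtype.ext (congrArg (fun z : A => (z : K)) hab)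
  have : Algebra.IsAlgebraic R A := ⟨fun a => by
    rw [← isAlgebraic_algebraMap_iff (A := K) Subtype.val_injective]
    exact a.2⟩
  exact hm (hmA.restrictScalars R)

theorem AlgebraicIndependent.transcendental_closure_singleton {x m : K}
    (h : AlgebraicIndependent ℤ ![x, m]) : Transcendental (Subfield.closure {x}) m := by
  have h1 := h.transcendental_adjoin (s := {0}) (i := 1) (by simp)
  exact PseudoFinite.transcendental_closure_singleton h1 (isAlgebraic_algebraMap
    (⟨x, Algebra.subset_adjoin ⟨0, rfl, rfl⟩⟩ : Algebra.adjoin ℤ (![x, m] '' {0})))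

/-- If every relation between `x` and `m` persists when `x` is replaced by any element of an
infinite field, then only the transcendence of `m` remains to be checked. -/
theorem algebraicIndependent_of_specializations {L : Type*} [Field L] [Infinite L] {x m : K}
    {m' : L} (hm : Transcendental ℤ m')
    (h : ∀ (v : L) (f : MvPolynomial (Fin 2) ℤ),
      MvPolynomial.aeval ![x, m] f = 0 → MvPolynomial.aeval ![v, m'] f = 0) :
    AlgebraicIndependent ℤ ![x, m] := by
  have hinj : Function.Injective (MvPolynomial.aeval (fun _ : Fin 1 => m') :
      MvPolynomial (Fin 1) ℤ →ₐ[ℤ] L) :=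
    (algebraicIndependent_unique_type_iff (x := fun _ : Fin 1 => m')).mpr hm
  rw [algebraicIndependent_iff]
  intro f hf
  set φ : MvPolynomial (Fin 1) ℤ →+* L :=
    RingHomClass.toRingHom (MvPolynomial.aeval (fun _ : Fin 1 => m') :
      MvPolynomial (Fin 1) ℤ →ₐ[ℤ] L) with hφ
  set P := (MvPolynomial.finSuccEquiv ℤ 1 f).map φ with hP
  have hv (v : L) : P.eval v = 0 := by
    have heq : ((Polynomial.evalRingHom v).comp ((Polynomial.mapRingHom φ).comp
        (MvPolynomial.finSuccEquiv ℤ 1 : MvPolynomial (Fin 2) ℤ →+* _))) =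
        ((MvPolynomial.aeval ![v, m'] : MvPolynomial (Fin 2) ℤ →ₐ[ℤ] L) :
          MvPolynomial (Fin 2) ℤ →+* L) := by
      refine MvPolynomial.ringHom_ext (fun n => by simp) fun i => ?_
      refine Fin.cases ?_ (fun j => ?_) i
      · simp [MvPolynomial.finSuccEquiv_X_zero]
      · have hX := MvPolynomial.finSuccEquiv_X_succ (R := ℤ) (j := j)
        change Polynomial.eval v
          (Polynomial.map φ (MvPolynomial.finSuccEquiv ℤ 1 (MvPolynomial.X j.succ))) = _
        rw [hX, Subsingleton.elim j 0]
        simp [hφ]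
    have := congrArg (fun g : MvPolynomial (Fin 2) ℤ →+* L => g f) heq
    exact this.trans (h v f hf)
  -- `P` is `f` as a polynomial in its first variable, with `m'` put for the second one.
  have hP0 : P = 0 := Polynomial.eq_zero_of_infinite_isRoot P
    (Set.infinite_univ.mono fun v _ => hv v)
  have hφinj : Function.Injective φ := hinj
  rw [hP, Polynomial.map_eq_zero_iff hφinj] at hP0
  exact (MvPolynomial.finSuccEquiv ℤ 1).injective (by rw [hP0, map_zero])

end Algebra

/-! ### The partial homomorphism on the ultraproduct -/

section Ultraproduct

open scoped Nat

variable {D : Ultrafilter Nat.Primes}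

theorem mk_eq_mk_iff {x y : (p : Nat.Primes) → ZMod p} :
    (Ideal.Quotient.mk (nullIdeal D) x : Fp D) = Ideal.Quotient.mk (nullIdeal D) y ↔
      ∀ᶠ p in (D : Filter Nat.Primes), x p = y p := by
  rw [Ideal.Quotient.eq, mem_nullIdeal]
  simp [sub_eq_zero]

theorem coe_dvd_coe {f g : Nat.Primes → ℤ}
    (h : ∀ᶠ p in (D : Filter Nat.Primes), f p ∣ g p) :
    (f : StarZ D) ∣ (g : StarZ D) := by
  refine ⟨((fun p => g p / f p : Nat.Primes → ℤ) : StarZ D), ?_⟩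
  rw [← Germ.coe_mul, Germ.coe_eq]
  filter_upwards [h] with p hp
  exact (Int.mul_ediv_cancel' hp).symm

theorem eventually_dvd_of_dvd {f g : Nat.Primes → ℤ} (h : (f : StarZ D) ∣ (g : StarZ D)) :
    ∀ᶠ p in (D : Filter Nat.Primes), f p ∣ g p := by
  obtain ⟨c, hc⟩ := h
  induction c using Germ.inductionOn with | _ c
  rw [← Germ.coe_mul, Germ.coe_eq] at hc
  filter_upwards [hc] with p hp
  exact ⟨c p, hp⟩

/-- A family of primitive roots is a generator: discrete logarithms are taken coordinatewise. -/
theorem isGenerator_mk {ε : (p : Nat.Primes) → ZMod p}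
    (hε : ∀ᶠ p : Nat.Primes in (D : Filter Nat.Primes), IsPrimitiveRoot (ε p) ((p : ℕ) - 1)) :
    IsGenerator (D := D) (Ideal.Quotient.mk (nullIdeal D) ε) := by
  classical
  constructor
  · rw [Ne, Ideal.Quotient.eq_zero_iff_mem, mem_nullIdeal]
    intro h
    obtain ⟨p, hp, h0⟩ := (hε.and h).exists
    exact hp.ne_zero (Nat.sub_pos_of_lt p.2.one_lt).ne' h0
  · intro x hx
    obtain ⟨x, rfl⟩ := Ideal.Quotient.mk_surjective x
    rw [Ne, Ideal.Quotient.eq_zero_iff_mem, mem_nullIdeal] at hx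
    have hx' := Ultrafilter.eventually_not.mpr hx
    have hpow : ∀ᶠ p : Nat.Primes in (D : Filter Nat.Primes), ∃ n : ℕ, ε p ^ n = x p := by
      filter_upwards [hε, hx'] with p hp h0
      have : NeZero ((p : ℕ) - 1) := ⟨(Nat.sub_pos_of_lt p.2.one_lt).ne'⟩
      obtain ⟨n, -, hn⟩ := hp.eq_pow_of_pow_eq_one (ZMod.pow_card_sub_one_eq_one h0)
      exact ⟨n, hn⟩
    refine ⟨((fun p => if h : ∃ n : ℕ, ε p ^ n = x p then (h.choose : ℤ) else 0 :
      Nat.Primes → ℤ) : StarZ D), ?_⟩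
    refine mk_eq_mk_iff.mpr ?_
    filter_upwards [hpow] with p hp
    simp only [dif_pos hp, zpow_natCast]
    exact hp.choose_spec

/-- The value of `ζ` modulo `p` attached to the primitive root `ε`. -/
def rootRes (k : ℕ) (p : Nat.Primes) (ε : ZMod p) : ZMod p :=
  ε ^ (((p : ℕ) - 1) / rootOrder k)

/-- The value of `θ` modulo `p` attached to the primitive root `ε`. -/
def realRes (k : ℕ) (p : Nat.Primes) (ι : ℕ) (ε : ZMod p) : ZMod p :=
  ε ^ (((p : ℕ) - 1) / (rootOrder k * ι ^ 2))

/-- The partial homomorphism from the ultraproduct of the `ZMod p` to the nonstandard complex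
numbers that sends the values of `ι`, `ζ`, `θ` modulo `p` to `w`, `rootValue` and `realValue`. It is
defined on the values of relation polynomials of finite complexity relative to the level `κ`. -/
def relSubring (D : Ultrafilter Nat.Primes) (κ ι : Nat.Primes → ℕ) (ε : (p : Nat.Primes) → ZMod p)
    (w : Nat.Primes → ℂ) : Subring (Fp D × StarC D) where
  carrier := {z | ∃ (n : ℕ) (g : Nat.Primes → RelPoly),
    (∀ᶠ p in (D : Filter Nat.Primes), g p ∈ levelFiltration (κ p) n) ∧
    z = (Ideal.Quotient.mk (nullIdeal D) fun p => evalRel (ι p : ZMod p)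
          (rootRes (κ p) p (ε p)) (realRes (κ p) p (ι p) (ε p)) (g p),
        ((fun p => evalRel (w p) (rootValue (κ p)) (realValue (κ p)) (g p) : Nat.Primes → ℂ) :
          StarC D))}
  zero_mem' := ⟨0, fun _ => 0, Eventually.of_forall fun p => by
    simp [levelFiltration, levelGenerators], by simp only [map_zero]; rfl⟩
  one_mem' := ⟨0, fun _ => 1, Eventually.of_forall fun p => by
    simp [levelFiltration, levelGenerators], by simp only [map_one]; rfl⟩
  neg_mem' := by
    rintro _ ⟨n, g, hg, rfl⟩
    refine ⟨n + 1, fun p => -g p, ?_, ?_⟩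
    · exact hg.mono fun p hp => Or.inr (Or.inr ⟨g p, hp, rfl⟩)
    · simp only [evalRel_neg]
      rfl
  add_mem' := by
    rintro _ _ ⟨n, g, hg, rfl⟩ ⟨m, h, hh, rfl⟩
    refine ⟨max n m + 1, fun p => g p + h p, ?_, ?_⟩
    · filter_upwards [hg, hh] with p hp hp'
      exact Or.inl ⟨_, levelFiltration_mono _ (le_max_left n m) hp, _,
        levelFiltration_mono _ (le_max_right n m) hp', rfl⟩
    · simp only [map_add]
      rfl
  mul_mem' := by
    rintro _ _ ⟨n, g, hg, rfl⟩ ⟨m, h, hh, rfl⟩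
    refine ⟨max n m + 1, fun p => g p * h p, ?_, ?_⟩
    · filter_upwards [hg, hh] with p hp hp'
      refine Or.inr (Or.inl ⟨_, levelFiltration_mono _ (le_max_left n m) hp, _,
        levelFiltration_mono _ (le_max_right n m) hp', rfl⟩)
    · simp only [map_mul]
      rfl

variable {κ ι : Nat.Primes → ℕ} {ε : (p : Nat.Primes) → ZMod p} {w : Nat.Primes → ℂ}

theorem mem_relSubring {n : ℕ} {g : Nat.Primes → RelPoly}
    (hg : ∀ᶠ p in (D : Filter Nat.Primes), g p ∈ levelFiltration (κ p) n) :
    ((Ideal.Quotient.mk (nullIdeal D) fun p => evalRel (ι p : ZMod p)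
          (rootRes (κ p) p (ε p)) (realRes (κ p) p (ι p) (ε p)) (g p) : Fp D),
        ((fun p => evalRel (w p) (rootValue (κ p)) (realValue (κ p)) (g p) : Nat.Primes → ℂ) :
          StarC D)) ∈ relSubring D κ ι ε w :=
  ⟨n, g, hg, rfl⟩

theorem mu_mem_relSubring :
    (red D ((fun p => ((κ p)! : ℤ) : Nat.Primes → ℤ) : StarZ D),
      toC ((fun p => ((κ p)! : ℤ) : Nat.Primes → ℤ) : StarZ D)) ∈ relSubring D κ ι ε w := by
  convert mem_relSubring (n := 0)
    (g := fun p => Polynomial.C (Polynomial.C (Polynomial.C (((κ p)! : ℕ) : ℤ))))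
    (Eventually.of_forall fun p => Or.inl (Or.inr (Or.inr (Or.inl rfl)))) using 2
  · refine mk_eq_mk_iff.mpr (Eventually.of_forall fun p => ?_)
    simp
  · refine Germ.coe_eq.mpr (Eventually.of_forall fun p => ?_)
    simp

theorem iota_mem_relSubring :
    (red D ((fun p => (ι p : ℤ) : Nat.Primes → ℤ) : StarZ D), (w : StarC D)) ∈
      relSubring D κ ι ε w := by
  convert mem_relSubring (n := 0)
    (g := fun p => Polynomial.C (Polynomial.C Polynomial.X))
    (Eventually.of_forall fun p => Or.inl (Or.inr (Or.inr (Or.inr rfl)))) using 2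
  · refine mk_eq_mk_iff.mpr (Eventually.of_forall fun p => ?_)
    simp [evalRel_C, evalCoeff, -map_pow]
  · refine Germ.coe_eq.mpr (Eventually.of_forall fun p => ?_)
    simp [evalRel_C, evalCoeff, -map_pow]

theorem root_pow_mem_relSubring {u : Nat.Primes → ℕ}
    (hu : ∀ᶠ p in (D : Filter Nat.Primes), u p ≤ κ p * (κ p)! ^ 4) :
    ((Ideal.Quotient.mk (nullIdeal D) fun p => rootRes (κ p) p (ε p) ^ u p : Fp D),
      ((fun p => rootValue (κ p) ^ u p : Nat.Primes → ℂ) : StarC D)) ∈ relSubring D κ ι ε w := by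
  convert mem_relSubring (n := 0) (g := fun p => Polynomial.C (Polynomial.X ^ u p))
    (hu.mono fun p hp => Or.inr (Or.inl ⟨u p, hp, rfl⟩)) using 2
  · refine mk_eq_mk_iff.mpr (Eventually.of_forall fun p => ?_)
    simp [evalRel_C, evalCoeff, -map_pow]
  · refine Germ.coe_eq.mpr (Eventually.of_forall fun p => ?_)
    simp [evalRel_C, evalCoeff, -map_pow]

theorem real_pow_mem_relSubring {u : Nat.Primes → ℕ}
    (hu : ∀ᶠ p in (D : Filter Nat.Primes), u p ≤ κ p * (κ p)! ^ 4) :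
    ((Ideal.Quotient.mk (nullIdeal D) fun p => realRes (κ p) p (ι p) (ε p) ^ u p : Fp D),
      ((fun p => realValue (κ p) ^ u p : Nat.Primes → ℂ) : StarC D)) ∈ relSubring D κ ι ε w := by
  convert mem_relSubring (n := 0) (g := fun p => Polynomial.X ^ u p)
    (hu.mono fun p hp => Or.inr (Or.inr ⟨u p, hp, rfl⟩)) using 2
  · refine mk_eq_mk_iff.mpr (Eventually.of_forall fun p => ?_)
    simp [evalRel]
  · refine Germ.coe_eq.mpr (Eventually.of_forall fun p => ?_)
    simp [evalRel]

variable {W : Set ℂ}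

/-- Genericity up to the level `κ`, which exceeds every standard complexity, makes the partial
homomorphism well defined. -/
theorem isFunctional_relSubring
    (hκ : ∀ n, ∀ᶠ p : Nat.Primes in (D : Filter Nat.Primes), n ≤ κ p)
    (hgen : ∀ᶠ p : Nat.Primes in (D : Filter Nat.Primes), IsGeneric (κ p) p (ι p) (ε p) W)
    (hw : ∀ p, w p ∈ W) : IsFunctional (relSubring D κ ι ε w) := by
  rintro y ⟨n, g, hg, hy⟩
  rw [Prod.mk.injEq] at hy
  have h0 := mem_nullIdeal.mp (Ideal.Quotient.eq_zero_iff_mem.mp hy.1.symm)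
  rw [hy.2]
  refine Germ.coe_eq.mpr ?_
  filter_upwards [h0, hg, hκ n, hgen] with p hp hgp hn hG
  exact hG.eval _ (levelFiltration_mono _ hn hgp) hp _ (hw p)

/-- Integral relations are respected by a partial homomorphism. -/
theorem IsFunctional.aeval_eq_zero {K Ω : Type*} [Field K] [Field Ω] {G : Subring (K × Ω)}
    (hG : IsFunctional G) {σ : Type*} {x : σ → K} {y : σ → Ω} (h : ∀ i, (x i, y i) ∈ G)
    {f : MvPolynomial σ ℤ} (hf : MvPolynomial.aeval x f = 0) : MvPolynomial.aeval y f = 0 := by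
  let z : σ → G := fun i => ⟨(x i, y i), h i⟩
  have h1 : (RingHom.fst K Ω).comp
      (G.subtype.comp (MvPolynomial.aeval z : MvPolynomial σ ℤ →ₐ[ℤ] G).toRingHom) =
      (MvPolynomial.aeval x : MvPolynomial σ ℤ →ₐ[ℤ] K).toRingHom :=
    MvPolynomial.ringHom_ext (fun n => by simp) fun i => by simp [z]
  have h2 : (RingHom.snd K Ω).comp
      (G.subtype.comp (MvPolynomial.aeval z : MvPolynomial σ ℤ →ₐ[ℤ] G).toRingHom) =
      (MvPolynomial.aeval y : MvPolynomial σ ℤ →ₐ[ℤ] Ω).toRingHom :=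
    MvPolynomial.ringHom_ext (fun n => by simp) fun i => by simp [z]
  have h1 := congrArg (fun g : MvPolynomial σ ℤ →+* K => g f) h1
  have h2 := congrArg (fun g : MvPolynomial σ ℤ →+* Ω => g f) h2
  refine h2.symm.trans (hG _ ?_)
  have h3 : (((MvPolynomial.aeval z f : G) : K × Ω).1) = 0 := h1.trans hf
  change (0, ((MvPolynomial.aeval z f : G) : K × Ω).2) ∈ G
  rw [← h3]
  exact (MvPolynomial.aeval z f).2

/-- A polynomial that vanishes at the factorial of the level for almost all `p` has infinitely many
roots, because the level is unbounded. -/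
theorem transcendental_toC_mu
    (hκ : ∀ n, ∀ᶠ p : Nat.Primes in (D : Filter Nat.Primes), n ≤ κ p) :
    Transcendental ℤ (toC ((fun p => ((κ p)! : ℤ) : Nat.Primes → ℤ) : StarZ D)) := by
  rw [transcendental_iff]
  intro f hf
  have heval : Polynomial.aeval (toC ((fun p => ((κ p)! : ℤ) : Nat.Primes → ℤ) : StarZ D)) f =
      ((fun p => ((f.eval ((κ p)! : ℤ) : ℤ) : ℂ) : Nat.Primes → ℂ) : StarC D) := by
    have h1 := Polynomial.aeval_algHom_apply
      (Germ.coeRingHom (D : Filter Nat.Primes) (R := ℂ)).toIntAlgHom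
      (fun p => (((κ p)! : ℤ) : ℂ)) f
    refine h1.trans (congrArg (fun h : Nat.Primes → ℂ => (h : StarC D)) (funext fun p => ?_))
    have h2 := Polynomial.aeval_algHom_apply
      (Pi.evalRingHom (fun _ : Nat.Primes => ℂ) p).toIntAlgHom
      (fun p => (((κ p)! : ℤ) : ℂ)) f
    have h3 := Polynomial.aeval_algHom_apply (Int.castRingHom ℂ).toIntAlgHom ((κ p)! : ℤ) f
    exact h2.symm.trans h3
  by_contra hne
  rw [heval] at hf
  have h0 : ∀ᶠ p in (D : Filter Nat.Primes), ((f.eval ((κ p)! : ℤ) : ℤ) : ℂ) = 0 :=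
    Germ.coe_eq.mp hf
  obtain ⟨M, hM⟩ := (f.roots.toFinset.finite_toSet).bddAbove
  obtain ⟨p, hp, hMp⟩ := (h0.and (hκ (M.toNat + 1))).exists
  have hroot : ((κ p)! : ℤ) ∈ f.roots := by
    rw [Polynomial.mem_roots hne]
    exact_mod_cast hp
  have h1 := hM (show ((κ p)! : ℤ) ∈ (f.roots.toFinset : Set ℤ) by simpa using hroot)
  have h2 := Nat.self_le_factorial (κ p)
  omega

end Ultraproduct

/-! ### Admissibility and the values of the place -/

section Assembly

open scoped Nat

variable {D : Ultrafilter Nat.Primes} {κ ι : Nat.Primes → ℕ} {ε : (p : Nat.Primes) → ZMod p}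
  {W : Set ℂ}

/-- The class of a family of natural numbers, as a nonstandard integer. -/
def natGerm (D : Ultrafilter Nat.Primes) (f : Nat.Primes → ℕ) : StarZ D :=
  ((fun p => (f p : ℤ) : Nat.Primes → ℤ) : StarZ D)

/-- The parameter `μ`: the class of the factorials of the level. -/
def muGerm (D : Ultrafilter Nat.Primes) (κ : Nat.Primes → ℕ) : StarZ D :=
  natGerm D fun p => (κ p)!

theorem red_pow (x : StarZ D) (n : ℕ) : red D (x ^ n) = red D x ^ n := by
  induction x using Germ.inductionOn with | _ f
  refine mk_eq_mk_iff.mpr (Eventually.of_forall fun p => ?_)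
  simp

theorem toC_pow (x : StarZ D) (n : ℕ) : toC (x ^ n) = toC x ^ n := by
  induction x using Germ.inductionOn with | _ f
  refine Germ.coe_eq.mpr (Eventually.of_forall fun p => ?_)
  simp

theorem admissible_of_isGeneric
    (hκ : ∀ n, ∀ᶠ p : Nat.Primes in (D : Filter Nat.Primes), n ≤ κ p)
    (hgen : ∀ᶠ p : Nat.Primes in (D : Filter Nat.Primes), IsGeneric (κ p) p (ι p) (ε p) W)
    (hdich : (natGerm D ι ^ 2) ^ 2 + 1 = npr D ∨
      AlgebraicIndependent ℤ ![red D (natGerm D ι ^ 2), red D (muGerm D κ ^ 2)])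
    (htrans : Transcendental (Subfield.closure {red D (natGerm D ι ^ 2)})
      (red D (muGerm D κ ^ 2))) :
    Admissible D (muGerm D κ) (natGerm D ι) where
  mu_pos := Germ.coe_pos.mpr (Eventually.of_forall fun p => by
    exact_mod_cast Nat.factorial_pos (κ p))
  iota_pos := Germ.coe_pos.mpr (hgen.mono fun p hp => by
    have := hp.growth
    have : 0 < ι p := Nat.pos_of_ne_zero (by rintro h; simp [h] at this)
    exact_mod_cast this)
  highly_divisible m hm := by
    refine coe_dvd_coe (f := fun _ => (m : ℤ)) (g := fun p => ((κ p)! : ℤ) ^ 2) ?_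
    filter_upwards [hκ m] with p hp
    exact_mod_cast (Nat.dvd_factorial hm hp).trans (dvd_pow_self _ two_ne_zero)
  dvd m hm := by
    refine coe_dvd_coe (f := fun p => (m : ℤ) * (((κ p)! : ℤ) ^ 2 * (ι p : ℤ) ^ 2))
      (g := fun p => ((p : ℕ) : ℤ) - 1) ?_
    filter_upwards [hκ m, hgen] with p hp hG
    have h1 : m * ((κ p)! ^ 2 * ι p ^ 2) ∣ (p : ℕ) - 1 := by
      refine (Nat.mul_dvd_mul (Nat.dvd_factorial hm hp) ?_).trans hG.dvd
      refine Nat.mul_dvd_mul ⟨2 * (κ p)! ^ 2, ?_⟩ dvd_rfl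
      rw [rootOrder]
      ring
    have h2 : (((p : ℕ) - 1 : ℕ) : ℤ) = ((p : ℕ) : ℤ) - 1 := by
      rw [Nat.cast_sub p.2.one_lt.le, Nat.cast_one]
    rw [← h2]
    exact_mod_cast h1
  growth n := by
    refine (Germ.coe_lt (f := fun p => (((κ p)! : ℤ) ^ 2) ^ n)
      (g := fun p => (ι p : ℤ) ^ 2)).mpr ?_
    filter_upwards [hκ n, hgen] with p hp hG
    have h1 : ((κ p)! ^ 2) ^ n ≤ ((κ p)! ^ 2) ^ κ p :=
      Nat.pow_le_pow_right (Nat.pow_pos (Nat.factorial_pos _)) hp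
    exact_mod_cast h1.trans_lt hG.growth
  dichotomy := hdich
  transcendental := htrans

/-- The partial homomorphism sends `μ` to a transcendental number, so `μ` is transcendental. -/
theorem transcendental_red_mu
    (hκ : ∀ n, ∀ᶠ p : Nat.Primes in (D : Filter Nat.Primes), n ≤ κ p)
    (hgen : ∀ᶠ p : Nat.Primes in (D : Filter Nat.Primes), IsGeneric (κ p) p (ι p) (ε p) W)
    (hW : W.Nonempty) : Transcendental ℤ (red D (muGerm D κ ^ 2)) := by
  obtain ⟨w, hw⟩ := hW
  rw [red_pow]
  refine Transcendental.pow (n := 2) ?_ two_pos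
  rw [← algebraicIndependent_unique_type_iff (x := fun _ : Fin 1 => red D (muGerm D κ)),
    algebraicIndependent_iff]
  intro f hf
  refine algebraicIndependent_iff.mp ((algebraicIndependent_unique_type_iff
    (x := fun _ : Fin 1 => toC (muGerm D κ))).mpr (transcendental_toC_mu hκ)) f ?_
  exact (isFunctional_relSubring (w := fun _ => w) hκ hgen fun _ => hw).aeval_eq_zero
    (fun _ => mu_mem_relSubring) hf

/-- When genericity allows every complex value for `ι`, there are partial homomorphisms that send
`ι` to any nonstandard complex number and fix the transcendental number `μ`. -/
theorem algebraicIndependent_red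
    (hκ : ∀ n, ∀ᶠ p : Nat.Primes in (D : Filter Nat.Primes), n ≤ κ p)
    (hgen : ∀ᶠ p : Nat.Primes in (D : Filter Nat.Primes),
      IsGeneric (κ p) p (ι p) (ε p) Set.univ) :
    AlgebraicIndependent ℤ ![red D (natGerm D ι ^ 2), red D (muGerm D κ ^ 2)] := by
  have hm : Transcendental ℤ (toC (muGerm D κ) ^ 2) :=
    (transcendental_toC_mu hκ).pow two_pos
  refine algebraicIndependent_of_specializations (L := StarC D) hm fun v f hf => ?_
  obtain ⟨s, hs⟩ := IsAlgClosed.exists_pow_nat_eq v two_pos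
  induction s using Germ.inductionOn with | _ s
  have hfun := isFunctional_relSubring (w := s) hκ hgen fun _ => Set.mem_univ _
  refine hfun.aeval_eq_zero (fun i => ?_) hf
  refine Fin.cases ?_ (fun j => ?_) i
  · rw [Matrix.cons_val_zero, Matrix.cons_val_zero, red_pow, ← hs]
    exact Subring.pow_mem _ iota_mem_relSubring 2
  · rw [Matrix.cons_val_succ, Matrix.cons_val_succ, Subsingleton.elim j 0,
      Matrix.cons_val_zero, Matrix.cons_val_zero, red_pow]
    exact Subring.pow_mem _ mu_mem_relSubring 2

/-- Negative powers are handled by the fact that a place respects inverses. -/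
theorem Place.map_zpow_of_bounded {I : Place (Fp D) (StarC D)} {x : (p : Nat.Primes) → ZMod p}
    {y : Nat.Primes → ℂ} (hx : ∀ᶠ p in (D : Filter Nat.Primes), x p ≠ 0) (hy : ∀ p, y p ≠ 0)
    {b : Nat.Primes → ℕ}
    (h : ∀ u : Nat.Primes → ℕ, (∀ᶠ p in (D : Filter Nat.Primes), u p ≤ b p) →
      I.toFun (Ideal.Quotient.mk (nullIdeal D) fun p => x p ^ u p) =
        (((fun p => y p ^ u p : Nat.Primes → ℂ) : StarC D) : OnePoint (StarC D)))
    {u : Nat.Primes → ℤ} (hu : ∀ᶠ p in (D : Filter Nat.Primes), |u p| ≤ b p) :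
    I.toFun (Ideal.Quotient.mk (nullIdeal D) fun p => x p ^ u p) =
      (((fun p => y p ^ u p : Nat.Primes → ℂ) : StarC D) : OnePoint (StarC D)) := by
  have h' := h (fun p => (u p).natAbs) (hu.mono fun p hp => by
    rw [Int.abs_eq_natAbs] at hp
    exact_mod_cast hp)
  have hor : ∀ᶠ p in (D : Filter Nat.Primes), 0 ≤ u p ∨ u p ≤ 0 :=
    Eventually.of_forall fun p => le_total _ _
  rcases Ultrafilter.eventually_or.mp hor with hpos | hneg
  · convert h' using 1
    · refine congrArg _ (mk_eq_mk_iff.mpr ?_)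
      filter_upwards [hpos] with p hp
      rw [← zpow_natCast, Int.natAbs_of_nonneg hp]
    · refine congrArg _ (Germ.coe_eq.mpr ?_)
      filter_upwards [hpos] with p hp
      rw [← zpow_natCast, Int.natAbs_of_nonneg hp]
  · have hne : ((fun p => y p ^ (u p).natAbs : Nat.Primes → ℂ) : StarC D) ≠ 0 := by
      intro h0
      obtain ⟨p, hp⟩ := (Germ.coe_eq.mp h0).exists
      exact pow_ne_zero _ (hy p) hp
    convert I.map_inv h' hne using 1
    · refine congrArg _ (eq_inv_of_mul_eq_one_left ?_)
      refine (mk_eq_mk_iff (x := fun p => x p ^ u p * x p ^ (u p).natAbs)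
        (y := fun _ => 1)).mpr ?_
      filter_upwards [hneg, hx] with p hp hx0
      have : u p = -((u p).natAbs : ℤ) := by omega
      nth_rewrite 1 [this]
      rw [zpow_neg, zpow_natCast, inv_mul_cancel₀ (pow_ne_zero _ hx0)]
    · refine congrArg _ (Germ.coe_eq.mpr ?_)
      filter_upwards [hneg] with p hp
      have : u p = -((u p).natAbs : ℤ) := by omega
      rw [this, zpow_neg, zpow_natCast]
      simp

/-- The integers `a * M * 𝔩`, where `a` is rational and `|M| < 𝔩`, within the range of exponents
allowed at the level `κ`. -/
theorem exists_scaled_exponent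
    (hκ : ∀ n, ∀ᶠ p : Nat.Primes in (D : Filter Nat.Primes), n ≤ κ p) (a : ℚ)
    {m : Nat.Primes → ℤ}
    (hm : ∀ᶠ p in (D : Filter Nat.Primes), |m p| < ((κ p)! : ℤ) ^ 2) :
    ∃ u : Nat.Primes → ℤ,
      (∀ᶠ p in (D : Filter Nat.Primes), |u p| ≤ ((κ p * (κ p)! ^ 4 : ℕ) : ℤ)) ∧
      ∀ᶠ p in (D : Filter Nat.Primes), (u p : ℂ) = a * m p * ((κ p)! : ℂ) ^ 2 := by
  refine ⟨fun p => a.num * m p * (((κ p)! ^ 2 / a.den : ℕ) : ℤ), ?_, ?_⟩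
  · filter_upwards [hκ a.num.natAbs, hm] with p hp hmp
    have h1 : |a.num| ≤ (κ p : ℤ) := by
      rw [Int.abs_eq_natAbs]
      exact_mod_cast hp
    have h2 : (((κ p)! ^ 2 / a.den : ℕ) : ℤ) ≤ ((κ p)! : ℤ) ^ 2 := by
      exact_mod_cast Nat.div_le_self _ _
    rw [abs_mul, abs_mul, Nat.abs_cast]
    calc |a.num| * |m p| * (((κ p)! ^ 2 / a.den : ℕ) : ℤ)
        ≤ (κ p : ℤ) * ((κ p)! : ℤ) ^ 2 * ((κ p)! : ℤ) ^ 2 := by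
          gcongr
      _ = ((κ p * (κ p)! ^ 4 : ℕ) : ℤ) := by
          push_cast
          ring
  · filter_upwards [hκ a.den] with p hp
    have hd : a.den ∣ (κ p)! ^ 2 :=
      (Nat.dvd_factorial a.pos hp).trans (dvd_pow_self _ two_ne_zero)
    have hden : (a.den : ℂ) ≠ 0 := by exact_mod_cast a.den_nz
    simp only [Int.cast_mul, Int.cast_natCast]
    rw [Nat.cast_div hd hden, Nat.cast_pow, show (a : ℂ) = a.num / a.den from Rat.cast_def a]
    field_simp

/-- The common form of the two prescriptions on the powers of the generator: the exponent is a
multiple `u` of `(𝔭 - 1) / d`, where `d = e * 𝔩`, and the value is the corresponding power of an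
exponential. -/
theorem exists_exponent_of_values
    (hκ : ∀ n, ∀ᶠ p : Nat.Primes in (D : Filter Nat.Primes), n ≤ κ p)
    (hε0 : ∀ᶠ p : Nat.Primes in (D : Filter Nat.Primes), ε p ≠ 0)
    {I : Place (Fp D) (StarC D)} {c : ℂ} {d : Nat.Primes → ℕ} {e : Nat.Primes → ℤ}
    (hd0 : ∀ᶠ p : Nat.Primes in (D : Filter Nat.Primes), d p ≠ 0)
    (hd : ∀ᶠ p : Nat.Primes in (D : Filter Nat.Primes), d p ∣ (p : ℕ) - 1)
    (hde : ∀ p, (d p : ℤ) = e p * ((κ p)! : ℤ) ^ 2)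
    (hI : ∀ u : Nat.Primes → ℕ,
      (∀ᶠ p in (D : Filter Nat.Primes), u p ≤ κ p * (κ p)! ^ 4) →
      I.toFun (Ideal.Quotient.mk (nullIdeal D) fun p => (ε p ^ (((p : ℕ) - 1) / d p)) ^ u p) =
        (((fun p => Complex.exp (-(2 * c / rootOrder (κ p))) ^ u p : Nat.Primes → ℂ) : StarC D) :
          OnePoint (StarC D)))
    (a : ℚ) {M : StarZ D} (hM : |M| < muGerm D κ ^ 2) :
    ∃ E : StarZ D,
      toC E = std D a * toC M * toC (npr D - 1) / toC (e : StarZ D) ∧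
      I.toFun (ipow (Ideal.Quotient.mk (nullIdeal D) ε) E) =
        (expC (-(std D a * toC M * std D c / toC (muGerm D κ ^ 2))) : StarC D) := by
  induction M using Germ.inductionOn with | _ m
  have hm : ∀ᶠ p in (D : Filter Nat.Primes), |m p| < ((κ p)! : ℤ) ^ 2 := by
    rw [Germ.abs_def] at hM
    exact Germ.coe_lt.mp hM
  obtain ⟨u, hu, hua⟩ := exists_scaled_exponent hκ a hm
  have hk (p : Nat.Primes) : ((κ p)! : ℂ) ≠ 0 := by
    exact_mod_cast (Nat.factorial_pos (κ p)).ne'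
  refine ⟨((fun p => ((((p : ℕ) - 1) / d p : ℕ) : ℤ) * u p : Nat.Primes → ℤ) : StarZ D), ?_, ?_⟩
  · refine Germ.coe_eq.mpr ?_
    filter_upwards [hua, hd, hd0] with p hp hdp hdp0
    have hdc : (d p : ℂ) = e p * ((κ p)! : ℂ) ^ 2 := by
      exact_mod_cast congrArg (Int.cast (R := ℂ)) (hde p)
    have hdp0' : (d p : ℂ) ≠ 0 := by exact_mod_cast hdp0
    have he0 : (e p : ℂ) ≠ 0 := fun h => hdp0' (by rw [hdc, h, zero_mul])
    change (((((p : ℕ) - 1) / d p : ℕ) : ℤ) * u p : ℤ) =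
      (a : ℂ) * (m p : ℂ) * ((((p : ℕ) : ℤ) - 1 : ℤ) : ℂ) / (e p : ℂ)
    rw [Int.cast_mul, Int.cast_natCast, Nat.cast_div hdp hdp0', hp, hdc,
      Nat.cast_sub p.2.one_lt.le]
    have := hk p
    push_cast
    field_simp
  · have h1 : ipow (Ideal.Quotient.mk (nullIdeal D) ε)
        ((fun p => ((((p : ℕ) - 1) / d p : ℕ) : ℤ) * u p : Nat.Primes → ℤ) : StarZ D) =
        Ideal.Quotient.mk (nullIdeal D) fun p => (ε p ^ (((p : ℕ) - 1) / d p)) ^ u p := by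
      refine mk_eq_mk_iff.mpr (Eventually.of_forall fun p => ?_)
      rw [zpow_mul, zpow_natCast]
    rw [h1]
    refine (Place.map_zpow_of_bounded (hε0.mono fun p hp => pow_ne_zero _ hp)
      (fun p => Complex.exp_ne_zero _) hI hu).trans (congrArg _ (Germ.coe_eq.mpr ?_))
    filter_upwards [hua] with p hp
    change _ = Complex.exp (-((a : ℂ) * (m p : ℂ) * c / ((((κ p)! : ℤ) ^ 2 : ℤ) : ℂ)))
    rw [← Complex.exp_int_mul, hp, rootOrder]
    have := hk p
    congr 1
    push_cast
    field_simp

theorem exists_hasValues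
    (hκ : ∀ n, ∀ᶠ p : Nat.Primes in (D : Filter Nat.Primes), n ≤ κ p)
    (hgen : ∀ᶠ p : Nat.Primes in (D : Filter Nat.Primes), IsGeneric (κ p) p (ι p) (ε p) W)
    (hW : Complex.exp (-(Real.pi * Complex.I / 4)) ∈ W) :
    ∃ I : Place (Fp D) (StarC D),
      HasValues (muGerm D κ) (natGerm D ι) (Ideal.Quotient.mk (nullIdeal D) ε) I := by
  set w : Nat.Primes → ℂ := fun _ => Complex.exp (-(Real.pi * Complex.I / 4)) with hw
  have hfun := isFunctional_relSubring (w := w) hκ hgen fun _ => hW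
  obtain ⟨I, hI⟩ := exists_place_of_isFunctional hfun
  have hε0 : ∀ᶠ p : Nat.Primes in (D : Filter Nat.Primes), ε p ≠ 0 :=
    hgen.mono fun p hp => hp.prim.ne_zero (Nat.sub_pos_of_lt p.2.one_lt).ne'
  have hmu := mu_mem_relSubring (D := D) (κ := κ) (ι := ι) (ε := ε) (w := w)
  have hio := iota_mem_relSubring (D := D) (κ := κ) (ι := ι) (ε := ε) (w := w)
  refine ⟨I, hI _ _ hmu, ?_, hI _ _ hio, ?_, ?_, ?_⟩
  · rw [red_pow, toC_pow]
    exact hI _ _ (Subring.pow_mem _ hmu 2)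
  · rw [red_pow]
    refine (hI _ _ (Subring.pow_mem _ hio 2)).trans (congrArg _ ?_)
    refine Germ.coe_eq.mpr (Eventually.of_forall fun p => ?_)
    change Complex.exp _ ^ 2 = Complex.exp _
    rw [← Complex.exp_nat_mul]
    congr 1
    push_cast
    ring
  · intro a M hM
    refine exists_exponent_of_values (d := fun p => rootOrder (κ p))
      (e := fun p => 2 * ((κ p)! : ℤ) ^ 2) hκ hε0 ?_ ?_ ?_ ?_ a hM
    · exact Eventually.of_forall fun p => by have := one_lt_rootOrder (κ p); omega
    · exact hgen.mono fun p hp => (dvd_mul_right _ _).trans ((dvd_mul_left _ _).trans hp.dvd)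
    · intro p
      simp only [rootOrder]
      push_cast
      ring
    · intro u hu
      refine (hI _ _ (root_pow_mem_relSubring hu)).trans (congrArg _ ?_)
      refine Germ.coe_eq.mpr (Eventually.of_forall fun p => ?_)
      simp only [rootValue]
      ring_nf
  · intro a M hM
    refine exists_exponent_of_values (d := fun p => rootOrder (κ p) * ι p ^ 2)
      (e := fun p => 2 * ((κ p)! : ℤ) ^ 2 * (ι p : ℤ) ^ 2) hκ hε0 ?_ ?_ ?_ ?_ a hM
    · refine hgen.mono fun p hp => ?_
      have h1 := one_lt_rootOrder (κ p)
      have h2 := hp.growth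
      exact mul_ne_zero (by omega) (by omega)
    · exact hgen.mono fun p hp => (dvd_mul_left _ _).trans hp.dvd
    · intro p
      simp only [rootOrder]
      push_cast
      ring
    · intro u hu
      exact hI _ _ (real_pow_mem_relSubring hu)

end Assembly

end PseudoFinite

open PseudoFinite in
theorem mainTheorem2 (D : Ultrafilter Nat.Primes) (hD : ∀ p : Nat.Primes, D ≠ pure p)
    (hdiv : ∀ m : ℕ, 0 < m → (m : PseudoFinite.StarZ D) ∣ PseudoFinite.npr D - 1) :
    (∃ μ ι : PseudoFinite.StarZ D, PseudoFinite.Admissible D μ ι ∧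
      AlgebraicIndependent ℤ ![PseudoFinite.red D (ι ^ 2), PseudoFinite.red D (μ ^ 2)] ∧
      ∃ ε : PseudoFinite.Fp D, PseudoFinite.IsGenerator ε ∧
        ∃ I : PseudoFinite.Place (PseudoFinite.Fp D) (PseudoFinite.StarC D),
          PseudoFinite.HasValues μ ι ε I) ∧
    (∀ ι : PseudoFinite.StarZ D, 0 < ι → (ι ^ 2) ^ 2 + 1 = PseudoFinite.npr D →
      ∃ μ : PseudoFinite.StarZ D, PseudoFinite.Admissible D μ ι ∧
        ∃ ε : PseudoFinite.Fp D, PseudoFinite.IsGenerator ε ∧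
          ∃ I : PseudoFinite.Place (PseudoFinite.Fp D) (PseudoFinite.StarC D),
            PseudoFinite.HasValues μ ι ε I) := by
  have hcof : (D : Filter Nat.Primes) ≤ cofinite :=
    D.le_cofinite_or_eq_pure.resolve_right fun ⟨p, hp⟩ => hD p hp
  have hdiv' : ∀ m : ℕ, 0 < m →
      ∀ᶠ p : Nat.Primes in (D : Filter Nat.Primes), m ∣ (p : ℕ) - 1 := by
    intro m hm
    have h := eventually_dvd_of_dvd (f := fun _ => (m : ℤ)) (g := fun p => ((p : ℕ) : ℤ) - 1)
      (hdiv m hm)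
    filter_upwards [h] with p hp
    rw [← Int.natCast_dvd_natCast, Nat.cast_sub p.2.one_lt.le]
    exact hp
  constructor
  · choose ι₀ hι₀ using exists_eventually_isGeneric_univ hcof hdiv'
    obtain ⟨κ, hκ, hQ⟩ := exists_level hcof (fun k _ => hι₀ k)
    classical
    -- The value `0` is only taken on a set of primes that is negligible for `D`.
    let ε : (p : Nat.Primes) → ZMod p := fun p =>
      if h : ∃ ε : ZMod p, IsGeneric (κ p) p (ι₀ (κ p)) ε Set.univ then h.choose else 0
    have hgen : ∀ᶠ p : Nat.Primes in (D : Filter Nat.Primes),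
        IsGeneric (κ p) p (ι₀ (κ p)) (ε p) Set.univ := by
      filter_upwards [hQ] with p hp
      simp only [ε, dif_pos hp]
      exact hp.choose_spec
    have hind := algebraicIndependent_red hκ hgen
    refine ⟨muGerm D κ, natGerm D fun p => ι₀ (κ p),
      admissible_of_isGeneric hκ hgen (Or.inr hind)
        hind.transcendental_closure_singleton, hind, Ideal.Quotient.mk (nullIdeal D) ε,
      isGenerator_mk (hgen.mono fun p hp => hp.prim), exists_hasValues hκ hgen (Set.mem_univ _)⟩
  · intro ι hιpos hι
    induction ι using Germ.inductionOn with | _ f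
    have hfpos : ∀ᶠ p in (D : Filter Nat.Primes), 0 < f p := Germ.coe_pos.mp hιpos
    have hf4 : ∀ᶠ p : Nat.Primes in (D : Filter Nat.Primes),
        (f p ^ 2) ^ 2 + 1 = ((p : ℕ) : ℤ) := Germ.coe_eq.mp hι
    have hιf : (f : StarZ D) = natGerm D fun p => (f p).toNat := by
      refine Germ.coe_eq.mpr ?_
      filter_upwards [hfpos] with p hp
      exact (Int.toNat_of_nonneg hp.le).symm
    rw [hιf] at hι ⊢
    have hι4 : ∀ᶠ p : Nat.Primes in (D : Filter Nat.Primes), (f p).toNat ^ 4 + 1 = (p : ℕ) := by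
      filter_upwards [hfpos, hf4] with p hp h4
      zify
      rw [Int.toNat_of_nonneg hp.le, ← h4]
      ring
    obtain ⟨κ, hκ, hQ⟩ := exists_level hcof
      (fun k hk => eventually_exists_isGeneric hcof hdiv' hι4 hk)
    classical
    let W : Set ℂ := {Complex.exp (-(Real.pi * Complex.I / 4))}
    let ε : (p : Nat.Primes) → ZMod p := fun p =>
      if h : ∃ ε : ZMod p, IsGeneric (κ p) p (f p).toNat ε W then h.choose else 0
    have hgen : ∀ᶠ p : Nat.Primes in (D : Filter Nat.Primes),
        IsGeneric (κ p) p (f p).toNat (ε p) W := by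
      filter_upwards [hQ] with p hp
      have hp' : ∃ ε : ZMod p, IsGeneric (κ p) p (f p).toNat ε W := hp
      simp only [ε, dif_pos hp']
      exact hp'.choose_spec
    -- In the ultraproduct `(ι ^ 2) ^ 2 = -1`.
    have halg : IsAlgebraic ℤ (red D (natGerm D (fun p => (f p).toNat) ^ 2)) := by
      refine ⟨Polynomial.X ^ 2 + 1, Polynomial.Monic.ne_zero (by monicity!), ?_⟩
      simp only [map_add, map_pow, Polynomial.aeval_X, map_one]
      refine (mk_eq_mk_iff (x := fun p => (((((f p).toNat : ℤ) ^ 2 : ℤ) : ZMod p)) ^ 2 + 1)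
        (y := fun _ => 0)).mpr ?_
      filter_upwards [hι4] with p hp
      have := congrArg (Nat.cast (R := ZMod p)) hp
      rw [ZMod.natCast_self] at this
      push_cast at this ⊢
      rw [← this]
      ring
    refine ⟨muGerm D κ, admissible_of_isGeneric hκ hgen (Or.inl hι)
      (transcendental_closure_singleton
        (transcendental_red_mu hκ hgen (Set.singleton_nonempty _)) halg),
      Ideal.Quotient.mk (nullIdeal D) ε,
      isGenerator_mk (hgen.mono fun p hp => hp.prim),
      exists_hasValues hκ hgen (Set.mem_singleton _)⟩
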